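/- Let $G=(V,E)$ be a finite, simple, connected graph with nonempty set $V_d\subseteq V$ of damped nodes, let $B\in\mathbb R^{V\times E}$ be an oriented incidence matrix of $G$ (each column has one entry $1$ and one entry $-1$, at the two endpoints of the edge, and zeros elsewhere), and let $r\ge 1$. Parameters $(M,R,W)$ consist of real $r\times r$ matrices $M_i,R_i$ ($i\in V$) and $W_e$ ($e\in E$). They are *feasible* if all $M_i$ and $W_e$ are diagonal and positive definite, all $R_i$ are symmetric positive semidefinite, and $R_i$ is positive definite exactly when $i\in V_d$. For a constant input $v\in(\mathbb R^r)^V$ consider, for momenta $p(t)\in(\mathbb R^r)^V$ and elongations $q(t)\in(\mathbb R^r)^E$, $t\ge 0$, the system $$\dot p_i=-R_iM_i^{-1}p_i-\sum_{e\in E}B_{ie}W_eq_e+v_i,\qquad \dot q_e=\sum_{i\in V}B_{ie}M_i^{-1}p_i,\qquad y_i=M_i^{-1}p_i .$$ For given parameters, the system is *GAS* if, for $v=0$ and on the invariant subspace $\Omega=\{(p,q): q\in\operatorname{im}(B\otimes I_r)^{T}\}$, the origin is Lyapunov stable and every trajectory converges to the origin. A *coloring* assigns to each node the color black, blue or red such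 that every node of $V_d$ is black. A black node is *poorly balanced* if all its neighbors are black, *richly balanced* if it has a red neighbor and a blue neighbor, and *unbalanced* otherwise. A coloring is *richly balanced* if it has a richly balanced black node and no unbalanced black node; it is *balanced* if it is richly balanced or all nodes are black. A node is *uncolorable* if it is black in every balanced coloring. Then the following statements are equivalent. 1. The damping graph is PI-GAS: the system is GAS for all feasible parameters. 2. The system is GAS for all feasible parameters with $R_i=0$ for every $i\notin V_d$. 3. For all feasible parameters, every constant input $v$ and every trajectory, there is $c\in\mathbb R^r$ with $y_i(t)\to c$ as $t\to\infty$ for all $i\in V$ (output consensus). 4. $\bigcup_{\tilde M,\tilde W}\{x\in\mathbb R^V: (B\tilde WB^T-\tilde M)x=0,\ x_i=0 \text{ for all } i\in V_d\}=\{0\}$, where $\tilde M\in\mathbb R^{V\times V}$ and $\tilde W\in\mathbb R^{E\times E}$ range over the diagonal positive definite matrices. 5. There is no nonzero $x\in\mathbb R^V$ with $x_i=0$ for all $i\in V_d$ such that every $i\in V$ with $x_i=0$ has a neighbor $j$ with $x_j<0$ if and only if it has a neighbor $k$ with $x_k>0$. 6. There is no nonzero sign vector $x\in\{-1,0,1\}^V$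 with the properties in 5. 7. There is no richly balanced coloring. 8. There is no coloring, with not all nodes black, in which every black node has a blue neighbor if and only if it has a red neighbor. 9. Every node is uncolorable. -/

import Mathlib

open scoped Matrix Topology

namespace MassSpring

/-! ### The network dynamics -/

/-- `B` is an oriented incidence matrix of the simple graph `G`: the column of each edge has
exactly one entry `1` and one entry `-1`, at the two endpoints, and zeros elsewhere. -/
def IsOrientedIncidence {V : Type*} (G : SimpleGraph V) (B : Matrix V G.edgeSet ℝ) : Prop :=
  ∀ e : G.edgeSet, ∃ i j : V, (e : Sym2 V) = s(i, j) ∧ B i e = 1 ∧ B j e = -1 ∧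
    ∀ k : V, k ≠ i → k ≠ j → B k e = 0

/-- The matrix parameters of a mass-spring-damper network whose nodes and springs have
dimension `r`: inertia and damping matrices at the nodes, weight matrices at the edges. -/
structure Params (V E : Type*) (r : ℕ) where
  M : V → Matrix (Fin r) (Fin r) ℝ
  R : V → Matrix (Fin r) (Fin r) ℝ
  W : E → Matrix (Fin r) (Fin r) ℝ

/-- Feasibility with respect to the set `Vd` of damped nodes: inertia and weight matrices are
diagonal and positive definite, damping matrices are positive semidefinite, and the nodes
with a positive definite damping matrix are exactly those of `Vd` (so that the other nodes are
undamped or partially undamped). -/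
def Params.Feasible {V E : Type*} {r : ℕ} (P : Params V E r) (Vd : Set V) : Prop :=
  (∀ i, (P.M i).IsDiag ∧ (P.M i).PosDef) ∧
  (∀ e, (P.W e).IsDiag ∧ (P.W e).PosDef) ∧
  (∀ i, (P.R i).PosSemidef) ∧
  (∀ i, (P.R i).PosDef ↔ i ∈ Vd)

/-- The state `(p, q)`: momenta of the masses and elongations of the springs. -/
abbrev State (V E : Type*) (r : ℕ) : Type _ := (V → Fin r → ℝ) × (E → Fin r → ℝ)

/-- The output `y`, i.e. the velocities `yᵢ = Mᵢ⁻¹ pᵢ`. -/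
noncomputable def output {V E : Type*} {r : ℕ} (P : Params V E r) (z : State V E r) :
    V → Fin r → ℝ :=
  fun i => (P.M i)⁻¹ *ᵥ z.1 i

/-- The right-hand side of the closed-loop system with constant external input `v`,
`ṗ = -R M⁻¹ p - (B ⊗ I) W q + v`, `q̇ = (B ⊗ I)ᵀ M⁻¹ p`, written block by block. -/
noncomputable def vectorField {V E : Type*} [Fintype V] [Fintype E] {r : ℕ}
    (B : Matrix V E ℝ) (P : Params V E r) (v : V → Fin r → ℝ) (z : State V E r) :
    State V E r :=
  (fun i => -(P.R i *ᵥ output P z i) - (∑ e, B i e • (P.W e *ᵥ z.2 e)) + v i,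
   fun e => ∑ i, B i e • output P z i)

/-- `z` restricted to `[0, ∞)` is a trajectory of the system with constant input `v`. -/
def IsTrajectory {V E : Type*} [Fintype V] [Fintype E] {r : ℕ}
    (B : Matrix V E ℝ) (P : Params V E r) (v : V → Fin r → ℝ) (z : ℝ → State V E r) : Prop :=
  ∀ t : ℝ, 0 ≤ t → HasDerivWithinAt z (vectorField B P v (z t)) (Set.Ici 0) t

/-- The invariant subspace `Ω` of states `(p, q)` with `q ∈ im (B ⊗ I)ᵀ`. -/
def Omega {V E : Type*} [Fintype V] {r : ℕ} (B : Matrix V E ℝ) : Set (State V E r) :=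
  {z | ∃ s : V → Fin r → ℝ, z.2 = fun e => ∑ i, B i e • s i}

/-- Global asymptotic stability of the origin for the shifted system (no external input) on
`Ω`: Lyapunov stability together with convergence of every trajectory to the origin. -/
def IsGAS {V E : Type*} [Fintype V] [Fintype E] {r : ℕ}
    (B : Matrix V E ℝ) (P : Params V E r) : Prop :=
  (∀ ε : ℝ, 0 < ε → ∃ δ : ℝ, 0 < δ ∧ ∀ z : ℝ → State V E r,
    IsTrajectory B P 0 z → z 0 ∈ Omega B → ‖z 0‖ < δ → ∀ t : ℝ, 0 ≤ t → ‖z t‖ < ε) ∧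
  (∀ z : ℝ → State V E r, IsTrajectory B P 0 z → z 0 ∈ Omega B →
    Filter.Tendsto z Filter.atTop (𝓝 0))

/-- Output consensus for the constant input `v`: along every trajectory, from any initial
state, the velocities of all nodes converge to one common vector. -/
def OutputConsensus {V E : Type*} [Fintype V] [Fintype E] {r : ℕ}
    (B : Matrix V E ℝ) (P : Params V E r) (v : V → Fin r → ℝ) : Prop :=
  ∀ z : ℝ → State V E r, IsTrajectory B P v z →
    ∃ c : Fin r → ℝ, Filter.Tendsto (fun t => output P (z t)) Filter.atTop (𝓝 fun _ => c)

/-- Parameter-independent global asymptotic stability. -/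
def IsPIGAS {V E : Type*} [Fintype V] [Fintype E] (r : ℕ)
    (B : Matrix V E ℝ) (Vd : Set V) : Prop :=
  ∀ P : Params V E r, P.Feasible Vd → IsGAS B P

/-- Parameter-independent global asymptotic stability when every node outside `Vd` is
completely undamped. -/
def IsPIGASUndamped {V E : Type*} [Fintype V] [Fintype E] (r : ℕ)
    (B : Matrix V E ℝ) (Vd : Set V) : Prop :=
  ∀ P : Params V E r, P.Feasible Vd → (∀ i, i ∉ Vd → P.R i = 0) → IsGAS B P

/-- Parameter-independent output consensus, for all feasible parameters and constant inputs. -/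
def IsPIConsensus {V E : Type*} [Fintype V] [Fintype E] (r : ℕ)
    (B : Matrix V E ℝ) (Vd : Set V) : Prop :=
  ∀ P : Params V E r, P.Feasible Vd → ∀ v : V → Fin r → ℝ, OutputConsensus B P v

/-- The union, over all diagonal positive definite matrices `M` and `W`, of the subspaces of
`ker (B W Bᵀ - M)` of vectors that vanish on the damped nodes. -/
def kernelUnion {V E : Type*} [Fintype V] [Fintype E]
    (B : Matrix V E ℝ) (Vd : Set V) : Set (V → ℝ) :=
  {x | ∃ (M : Matrix V V ℝ) (W : Matrix E E ℝ),
    (M.IsDiag ∧ M.PosDef) ∧ (W.IsDiag ∧ W.PosDef) ∧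
    (B * W * Bᵀ - M) *ᵥ x = 0 ∧ ∀ i ∈ Vd, x i = 0}

/-! ### Sign conditions and colorings -/

/-- `x` vanishes on `Vd`, and each zero of `x` has a neighbor with a negative value if and only
if it has a neighbor with a positive value. -/
def ZeroBalanced {V S : Type*} [Zero S] [LT S] (G : SimpleGraph V) (Vd : Set V)
    (x : V → S) : Prop :=
  (∀ i ∈ Vd, x i = 0) ∧
  (∀ i, x i = 0 → ((∃ j, G.Adj i j ∧ x j < 0) ↔ (∃ k, G.Adj i k ∧ 0 < x k)))

inductive Color where
  | black
  | blue
  | red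

/-- A coloring of a damping graph: damped nodes are black. -/
def IsColoring {V : Type*} (Vd : Set V) (c : V → Color) : Prop :=
  ∀ i ∈ Vd, c i = Color.black

/-- A black node all of whose neighbors are black. -/
def PoorNode {V : Type*} (G : SimpleGraph V) (c : V → Color) (i : V) : Prop :=
  c i = Color.black ∧ ∀ j, G.Adj i j → c j = Color.black

/-- A black node with at least one red and at least one blue neighbor. -/
def RichNode {V : Type*} (G : SimpleGraph V) (c : V → Color) (i : V) : Prop :=
  c i = Color.black ∧ (∃ j, G.Adj i j ∧ c j = Color.red) ∧ (∃ j, G.Adj i j ∧ c j = Color.blue)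

/-- A black node that is neither poorly nor richly balanced. -/
def UnbalancedNode {V : Type*} (G : SimpleGraph V) (c : V → Color) (i : V) : Prop :=
  c i = Color.black ∧ ¬ PoorNode G c i ∧ ¬ RichNode G c i

/-- A colored graph is poorly balanced if all its nodes are black. -/
def PoorlyBalanced {V : Type*} (c : V → Color) : Prop :=
  ∀ i, c i = Color.black

/-- A colored graph is richly balanced if it has a richly balanced black node and no unbalanced
black node. -/
def RichlyBalanced {V : Type*} (G : SimpleGraph V) (c : V → Color) : Prop :=
  (∃ i, RichNode G c i) ∧ ∀ i, ¬ UnbalancedNode G c i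

/-- A balanced colored graph is one that is poorly or richly balanced. -/
def Balanced {V : Type*} (G : SimpleGraph V) (c : V → Color) : Prop :=
  PoorlyBalanced c ∨ RichlyBalanced G c

/-- The set of uncolorable nodes: those that are black in every balanced coloring. -/
def uncolorable {V : Type*} (G : SimpleGraph V) (Vd : Set V) : Set V :=
  {i | ∀ c : V → Color, IsColoring Vd c → Balanced G c → c i = Color.black}

end MassSpring

/-!
The nine conditions are linked by three arguments.

*Dynamics and the kernel condition.* Write `L = B W Bᵀ` for a weighted Laplacian. If `L x = M x` with
`x ≠ 0` zero on the damped nodes, then `y = x cos t` is the output of an undamped oscillation of the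
network with masses `M` and weights `W` (`exists_oscillation`), so neither stability nor output
consensus holds. Conversely, the energy decreases along trajectories of the system without input and,
by LaSalle's principle (`tendsto_zero_of_energy`), all trajectories in `Ω` tend to zero unless some
nonzero trajectory feels no damping. The states of such trajectories form an invariant subspace; in
each of the `r` coordinates their velocities form a subspace, zero on the damped nodes and invariant
under `M⁻¹ L`. This operator is symmetric for a weighted inner product, so a nonzero subspace contains
an eigenvector, which the kernel condition and connectedness exclude (`eq_zero_of_invariant`,
`isGAS_of_kernel`). Stability gives output consensus for every constant input by shifting to an
equilibrium with a common velocity (`exists_equilibrium`, `outputConsensus_of_isGAS`).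

*The kernel condition and signs.* A solution of `L x = M x` has at each of its zeros neighbors of both
signs or none (`zeroBalanced_of_lap_eq`). Conversely, a balanced sign vector `x` is the sign pattern of
a solution (`exists_lap_eq_of_zeroBalanced`): multiply `x` by a rapidly saturating increasing function of the
distance to a damped node, so that at every nonzero node a neighbor nearer to the damped node outweighs
all others and `L y` has the sign of `y`; the weights of the edges at the zeros of `x` are free to make
`L y` vanish there; the masses are then the quotients of `L y` by `y`.

*Signs and colorings.* Reading `0`, `1`, `-1` as black, red and blue turns balanced sign vectors into
colorings; in a connected graph with a damped node, a coloring that is not entirely black has a black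
node with a neighbor of another color, which is rich if the coloring is balanced
(`exists_coloring_iff_richlyBalanced`).
-/

/-! ### Sign vectors and colorings -/

namespace MassSpring

/-- In a connected graph, some edge joins a node satisfying `p` to a node that does not, if both kinds
of node occur. -/
lemma exists_adj_of_connected {V : Type*} {G : SimpleGraph V} (hG : G.Connected) {p : V → Prop}
    {a b : V} (ha : p a) (hb : ¬ p b) : ∃ i j, G.Adj i j ∧ p i ∧ ¬ p j := by
  by_contra! h
  exact hb ((hG.preconnected a b).elim fun w => by
    induction w with
    | nil => exact ha
    | cons hadj _ ih => exact ih (h _ _ hadj ha) hb)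

lemma exists_zeroBalanced_real_iff_sign {V : Type*} (G : SimpleGraph V) (Vd : Set V) :
    (∃ x : V → ℝ, x ≠ 0 ∧ ZeroBalanced G Vd x) ↔
      ∃ x : V → SignType, x ≠ 0 ∧ ZeroBalanced G Vd x := by
  constructor
  · rintro ⟨x, hx, hb⟩
    refine ⟨fun i => SignType.sign (x i), ?_, ?_, ?_⟩
    · contrapose! hx
      funext i
      simpa using congrFun hx i
    · intro i hi
      simp [hb.1 i hi]
    · intro i hi
      have h := hb.2 i (by simpa using hi)
      simpa only [sign_eq_neg_one_iff, sign_eq_one_iff, SignType.neg_iff, SignType.pos_iff] using h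
  · rintro ⟨x, hx, hb⟩
    have hzero : ∀ s : SignType, (s : ℝ) = 0 ↔ s = 0 := by
      intro s; cases s <;> simp
    refine ⟨fun i => (x i : ℝ), ?_, ?_, ?_⟩
    · contrapose! hx
      funext i
      exact (hzero _).1 (congrFun hx i)
    · intro i hi
      simp [hb.1 i hi]
    · intro i hi
      have h := hb.2 i ((hzero _).1 hi)
      have hneg : ∀ s : SignType, (s : ℝ) < 0 ↔ s < 0 := by
        intro s; cases s <;> simp
      have hpos : ∀ s : SignType, 0 < (s : ℝ) ↔ 0 < s := by
        intro s; cases s <;> simp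
      simpa only [hneg, hpos] using h

/-- The coloring of a sign vector: black, red and blue stand for `0`, `1` and `-1`. -/
def colorOfSign : SignType → Color
  | 0 => Color.black
  | 1 => Color.red
  | -1 => Color.blue

/-- The sign of a color: `0`, `1` and `-1` stand for black, red and blue. -/
def signOfColor : Color → SignType
  | Color.black => 0
  | Color.red => 1
  | Color.blue => -1

lemma exists_zeroBalanced_sign_iff_coloring {V : Type*} (G : SimpleGraph V) (Vd : Set V) :
    (∃ x : V → SignType, x ≠ 0 ∧ ZeroBalanced G Vd x) ↔
      ∃ c : V → Color, IsColoring Vd c ∧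
        (∀ i, c i = Color.black →
          ((∃ j, G.Adj i j ∧ c j = Color.blue) ↔ (∃ k, G.Adj i k ∧ c k = Color.red))) ∧
        (∃ i, c i ≠ Color.black) := by
  constructor
  · rintro ⟨x, hx, hb⟩
    have h0 : ∀ s, colorOfSign s = Color.black ↔ s = 0 := by
      intro s; cases s <;> simp [colorOfSign]
    have h1 : ∀ s, colorOfSign s = Color.red ↔ 0 < s := by
      intro s; cases s <;> simp [colorOfSign]
    have h2 : ∀ s, colorOfSign s = Color.blue ↔ s < 0 := by
      intro s; cases s <;> simp [colorOfSign]
    refine ⟨fun i => colorOfSign (x i), fun i hi => (h0 _).2 (hb.1 i hi), fun i hi => ?_, ?_⟩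
    · simpa only [h1, h2] using hb.2 i ((h0 _).1 hi)
    · simpa only [ne_eq, h0, Pi.zero_apply] using Function.ne_iff.1 hx
  · rintro ⟨c, hc, hb, hne⟩
    have h0 : ∀ s, signOfColor s = 0 ↔ s = Color.black := by
      intro s; cases s <;> simp [signOfColor]
    have h1 : ∀ s, 0 < signOfColor s ↔ s = Color.red := by
      intro s; cases s <;> simp [signOfColor]
    have h2 : ∀ s, signOfColor s < 0 ↔ s = Color.blue := by
      intro s; cases s <;> simp [signOfColor]
    refine ⟨fun i => signOfColor (c i), ?_, fun i hi => (h0 _).2 (hc i hi), fun i hi => ?_⟩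
    · refine Function.ne_iff.2 ?_
      simpa only [Pi.zero_apply, ne_eq, h0] using hne
    · simpa only [h1, h2] using hb i ((h0 _).1 hi)

/-- A coloring that is not entirely black is richly balanced if and only if its black nodes see
either both of the other colors or none of them: since a damped node is black, some edge joins a
black node to a node of another color, and this black node is rich. -/
lemma exists_coloring_iff_richlyBalanced {V : Type*} {G : SimpleGraph V} (hG : G.Connected)
    {Vd : Set V} (hVd : Vd.Nonempty) :
    (∃ c : V → Color, IsColoring Vd c ∧
        (∀ i, c i = Color.black →
          ((∃ j, G.Adj i j ∧ c j = Color.blue) ↔ (∃ k, G.Adj i k ∧ c k = Color.red))) ∧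
        (∃ i, c i ≠ Color.black)) ↔
      ∃ c : V → Color, IsColoring Vd c ∧ RichlyBalanced G c := by
  refine exists_congr fun c => and_congr_right fun hc => ⟨?_, ?_⟩
  · rintro ⟨hb, b, hbb⟩
    obtain ⟨a, ha⟩ := hVd
    have key : ∀ i j, c i = Color.black → G.Adj i j → c j ≠ Color.black → RichNode G c i := by
      intro i j hi hij hj
      cases hcj : c j with
      | black => exact absurd hcj hj
      | blue => exact ⟨hi, (hb i hi).1 ⟨j, hij, hcj⟩, ⟨j, hij, hcj⟩⟩
      | red => exact ⟨hi, ⟨j, hij, hcj⟩, (hb i hi).2 ⟨j, hij, hcj⟩⟩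
    obtain ⟨i, j, hij, hi, hj⟩ :=
      exists_adj_of_connected hG (p := fun i => c i = Color.black) (hc a ha) hbb
    refine ⟨⟨i, key i j hi hij hj⟩, ?_⟩
    rintro i ⟨hi, hpoor, hrich⟩
    simp only [PoorNode, not_and, not_forall] at hpoor
    obtain ⟨j, hij, hj⟩ := hpoor hi
    exact hrich (key i j hi hij hj)
  · rintro ⟨⟨i, hi, ⟨j, hij, hj⟩, _⟩, hun⟩
    refine ⟨fun i hi => ?_, j, by simp [hj]⟩
    by_cases hp : PoorNode G c i
    · constructor <;> rintro ⟨j, hij, hj⟩ <;> simp [hp.2 j hij] at hj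
    · have hr : RichNode G c i := by
        by_contra hr
        exact hun i ⟨hi, hp, hr⟩
      exact ⟨fun _ => hr.2.1, fun _ => hr.2.2⟩

lemma uncolorable_eq_univ_iff {V : Type*} (G : SimpleGraph V) (Vd : Set V) :
    uncolorable G Vd = Set.univ ↔ ¬ ∃ c : V → Color, IsColoring Vd c ∧ RichlyBalanced G c := by
  rw [Set.eq_univ_iff_forall]
  constructor
  · rintro h ⟨c, hc, hr⟩
    obtain ⟨i, -, ⟨j, -, hj⟩, -⟩ := hr.1
    simp [h j c hc (Or.inr hr)] at hj
  · rintro h i c hc (hp | hr)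
    · exact hp i
    · exact absurd ⟨c, hc, hr⟩ h

end MassSpring

/-! ### The weighted Laplacian -/

namespace MassSpring

/-- The weighted Laplacian `B W Bᵀ` of a matrix `B` with edge weights `w`, as an operator on
vectors. -/
def lap {V E : Type*} [Fintype V] [Fintype E] (B : Matrix V E ℝ) (w : E → ℝ) (x : V → ℝ) :
    V → ℝ :=
  fun i => ∑ e, B i e * (w e * ∑ j, B j e * x j)

section
variable {V E : Type*} [Fintype V] [Fintype E] (B : Matrix V E ℝ) (w : E → ℝ)

lemma mulVec_eq_lap [DecidableEq E] (x : V → ℝ) :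
    (B * Matrix.diagonal w * Bᵀ) *ᵥ x = lap B w x := by
  rw [← Matrix.mulVec_mulVec, ← Matrix.mulVec_mulVec]
  funext i
  refine Finset.sum_congr rfl fun e _ => ?_
  rw [Matrix.mulVec_diagonal]
  rfl

lemma lap_add (x y : V → ℝ) : lap B w (x + y) = lap B w x + lap B w y := by
  funext i
  simp only [lap, Pi.add_apply, mul_add, Finset.sum_add_distrib]

lemma lap_smul (a : ℝ) (x : V → ℝ) : lap B w (a • x) = a • lap B w x := by
  funext i
  simp only [lap, Pi.smul_apply, smul_eq_mul, Finset.mul_sum]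
  exact Finset.sum_congr rfl fun e _ => Finset.sum_congr rfl fun j _ => by ring

/-- The bilinear form of the Laplacian, as a sum over the edges. -/
lemma sum_mul_lap (x y : V → ℝ) :
    ∑ i, x i * lap B w y i = ∑ e, w e * ((∑ i, B i e * x i) * ∑ i, B i e * y i) := by
  simp only [lap, Finset.mul_sum, Finset.sum_mul]
  rw [Finset.sum_comm]
  refine Finset.sum_congr rfl fun e _ => ?_
  rw [Finset.sum_comm]
  exact Finset.sum_congr rfl fun j _ => Finset.sum_congr rfl fun i _ => by ring

lemma sum_mul_lap_comm (x y : V → ℝ) :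
    ∑ i, lap B w x i * y i = ∑ i, x i * lap B w y i := by
  simp only [mul_comm (lap B w x _), sum_mul_lap, mul_comm (∑ i, B i _ * y i)]

variable {w} in
lemma sum_mul_lap_self_nonneg (hw : ∀ e, 0 < w e) (x : V → ℝ) : 0 ≤ ∑ i, x i * lap B w x i := by
  rw [sum_mul_lap]
  exact Finset.sum_nonneg fun e _ => mul_nonneg (hw e).le (mul_self_nonneg _)

variable {w} in
lemma edge_eq_zero_of_sum_mul_lap_self (hw : ∀ e, 0 < w e) {x : V → ℝ}
    (h : ∑ i, x i * lap B w x i = 0) (e : E) : ∑ i, B i e * x i = 0 := by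
  rw [sum_mul_lap, Finset.sum_eq_zero_iff_of_nonneg
    fun e _ => mul_nonneg (hw e).le (mul_self_nonneg _)] at h
  simpa [(hw e).ne'] using h e (Finset.mem_univ e)

end

section
variable {V : Type*} [Fintype V] {G : SimpleGraph V}
  {B : Matrix V G.edgeSet ℝ}

/-- The column of the edge from `a` to `b` acts on a vector as a difference. -/
lemma IsOrientedIncidence.exists_ends (hB : IsOrientedIncidence G B) (e : G.edgeSet) :
    ∃ a b, (e : Sym2 V) = s(a, b) ∧ a ≠ b ∧ B a e = 1 ∧ B b e = -1 ∧
      (∀ k, k ≠ a → k ≠ b → B k e = 0) ∧ ∀ x : V → ℝ, ∑ k, B k e * x k = x a - x b := by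
  obtain ⟨a, b, he, ha, hb, h0⟩ := hB e
  have hab : a ≠ b := by
    rintro rfl
    linarith
  refine ⟨a, b, he, hab, ha, hb, h0, fun x => ?_⟩
  rw [Finset.sum_eq_add a b hab (fun k _ hk => by rw [h0 k hk.1 hk.2, zero_mul]) (by simp) (by simp),
    ha, hb]
  ring

lemma IsOrientedIncidence.sum_column (hB : IsOrientedIncidence G B) (e : G.edgeSet) :
    ∑ i, B i e = 0 := by
  obtain ⟨a, b, -, -, -, -, -, h⟩ := hB.exists_ends e
  simpa using h 1

/-- On a connected graph, the kernel of `Bᵀ` consists of the constant vectors. -/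
lemma IsOrientedIncidence.eq_of_edge_eq_zero (hG : G.Connected) (hB : IsOrientedIncidence G B)
    {x : V → ℝ} (h : ∀ e, ∑ i, B i e * x i = 0) (i j : V) : x i = x j := by
  by_contra hij
  obtain ⟨a, b, hab, ha, hb⟩ :=
    exists_adj_of_connected hG (p := fun k => x k = x j) rfl hij
  obtain ⟨c, d, he, -, -, -, -, hcd⟩ := hB.exists_ends ⟨s(a, b), hab⟩
  have h1 : x c = x d := by
    rw [← sub_eq_zero, ← hcd]
    exact h _
  rcases Sym2.eq_iff.1 he with ⟨rfl, rfl⟩ | ⟨rfl, rfl⟩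
  · exact hb (h1 ▸ ha)
  · exact hb (h1 ▸ ha)

/-- The Laplacian as a sum over the nodes. -/
lemma IsOrientedIncidence.lap_apply [DecidableEq V] [DecidableRel G.Adj]
    (hB : IsOrientedIncidence G B)
    (w : G.edgeSet → ℝ) (x : V → ℝ) (i : V) :
    lap B w x i =
      ∑ j, (if h : G.Adj i j then w ⟨s(i, j), h⟩ else 0) * (x i - x j) := by
  have h1 : ∀ j, (if h : G.Adj i j then w ⟨s(i, j), h⟩ else 0) * (x i - x j) =
      ∑ e : G.edgeSet, if (e : Sym2 V) = s(i, j) then w e * (x i - x j) else 0 := by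
    intro j
    by_cases h : G.Adj i j
    · rw [Finset.sum_eq_single (⟨s(i, j), h⟩ : G.edgeSet)]
      · simp [h]
      · intro e _ he
        rw [if_neg fun h' => he (Subtype.ext h')]
      · simp
    · rw [Finset.sum_eq_zero]
      · simp [h]
      · intro e _
        rw [if_neg]
        intro he
        exact h (by simpa [he] using e.2)
  simp only [h1]
  rw [Finset.sum_comm, lap]
  refine Finset.sum_congr rfl fun e _ => ?_
  obtain ⟨a, b, he, hab, ha, hb, h0, hx⟩ := hB.exists_ends e
  rw [hx]
  by_cases hia : i = a
  · subst hia
    rw [Finset.sum_eq_single b]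
    · simp [he, ha]
    · intro j _ hj
      rw [if_neg]
      rw [he, Sym2.eq_iff]
      rintro (⟨-, h⟩ | ⟨-, h⟩)
      · exact hj h.symm
      · exact hab h.symm
    · simp
  by_cases hib : i = b
  · subst hib
    rw [Finset.sum_eq_single a]
    · rw [if_pos (he.trans Sym2.eq_swap), hb]
      ring
    · intro j _ hj
      rw [if_neg]
      rw [he, Sym2.eq_iff]
      rintro (⟨h, -⟩ | ⟨h, -⟩)
      · exact hab h
      · exact hj h.symm
    · simp
  · rw [h0 i hia hib, zero_mul, Finset.sum_eq_zero]
    intro j _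
    rw [if_neg]
    rw [he, Sym2.eq_iff]
    rintro (⟨h, -⟩ | ⟨-, h⟩)
    · exact hia h.symm
    · exact hib h.symm

/-- On a connected graph, the range of the Laplacian contains every vector of zero sum: `L + J`,
with `J` the all-ones matrix, is injective, and `J s` vanishes when `(L + J) s` has zero sum. -/
lemma IsOrientedIncidence.exists_lap_eq (hG : G.Connected) [Fintype G.edgeSet]
    (hB : IsOrientedIncidence G B) {w : G.edgeSet → ℝ} (hw : ∀ e, 0 < w e) {b : V → ℝ}
    (hb : ∑ i, b i = 0) : ∃ s, lap B w s = b := by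
  have hone : ∀ s, ∑ i, lap B w s i = 0 := by
    intro s
    have := sum_mul_lap B w 1 s
    simpa [hB.sum_column] using this
  let f : (V → ℝ) →ₗ[ℝ] (V → ℝ) :=
    { toFun := fun s i => lap B w s i + ∑ j, s j
      map_add' := fun s t => by
        funext i
        simp only [lap_add, Pi.add_apply, Finset.sum_add_distrib]
        ring
      map_smul' := fun a s => by
        funext i
        simp only [lap_smul, Pi.smul_apply, smul_eq_mul, ← Finset.mul_sum, RingHom.id_apply]
        ring }
  have hf : ∀ s i, f s i = lap B w s i + ∑ j, s j := fun _ _ => rfl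
  have hcard : (Fintype.card V : ℝ) ≠ 0 := by
    have := hG.nonempty
    exact_mod_cast Fintype.card_ne_zero
  -- A vector whose image under `L + J` has zero sum has itself zero sum.
  have hsum : ∀ s, ∑ i, f s i = 0 → ∑ j, s j = 0 := by
    intro s hs
    simpa [hf, Finset.sum_add_distrib, hone, hcard] using hs
  have hinj : Function.Injective f := by
    rw [← LinearMap.ker_eq_bot, LinearMap.ker_eq_bot']
    intro s hs
    have h0 : ∑ j, s j = 0 := hsum s (by simp [hs])
    have hl : ∀ i, lap B w s i = 0 := fun i => by
      have := congrFun hs i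
      rwa [hf, h0, add_zero] at this
    have hc := hB.eq_of_edge_eq_zero hG
      (edge_eq_zero_of_sum_mul_lap_self B hw (x := s) (by simp [hl]))
    funext i
    have h1 : ∑ j, s j = Fintype.card V * s i := by
      rw [Finset.sum_congr rfl fun j _ => hc j i]
      simp
    rw [h0] at h1
    simpa [hcard] using h1.symm
  obtain ⟨s, hs⟩ := LinearMap.injective_iff_surjective.1 hinj b
  refine ⟨s, funext fun i => ?_⟩
  have h0 := hsum s (by rw [hs, hb])
  rw [← hs, hf, h0, add_zero]

end

end MassSpring

/-! ### The kernel condition -/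

namespace MassSpring

lemma exists_diagonal_of_isDiag_posDef {n : Type*} [Fintype n] [DecidableEq n] {A : Matrix n n ℝ}
    (hd : A.IsDiag) (hp : A.PosDef) : ∃ d : n → ℝ, (∀ k, 0 < d k) ∧ A = Matrix.diagonal d := by
  refine ⟨A.diag, ?_, hd.diagonal_diag.symm⟩
  rw [← hd.diagonal_diag] at hp
  exact Matrix.posDef_diagonal_iff.1 hp

/-- The kernel condition in coordinates. -/
lemma kernelUnion_eq_singleton_iff {V E : Type*} [Fintype V] [Fintype E] (B : Matrix V E ℝ)
    (Vd : Set V) :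
    kernelUnion B Vd = {0} ↔ ∀ (m : V → ℝ) (w : E → ℝ) (x : V → ℝ), (∀ i, 0 < m i) →
      (∀ e, 0 < w e) → (∀ i, lap B w x i = m i * x i) → (∀ i ∈ Vd, x i = 0) → x = 0 := by
  classical
  have hmem : ∀ x, x ∈ kernelUnion B Vd ↔ ∃ (m : V → ℝ) (w : E → ℝ), (∀ i, 0 < m i) ∧
      (∀ e, 0 < w e) ∧ (∀ i, lap B w x i = m i * x i) ∧ ∀ i ∈ Vd, x i = 0 := by
    intro x
    have key : ∀ (m : V → ℝ) (w : E → ℝ),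
        (B * Matrix.diagonal w * Bᵀ - Matrix.diagonal m) *ᵥ x = 0 ↔
          ∀ i, lap B w x i = m i * x i := by
      intro m w
      rw [Matrix.sub_mulVec, mulVec_eq_lap, sub_eq_zero, funext_iff]
      simp only [Matrix.mulVec_diagonal]
    constructor
    · rintro ⟨M, W, ⟨hM, hM'⟩, ⟨hW, hW'⟩, hx, h0⟩
      obtain ⟨m, hm, rfl⟩ := exists_diagonal_of_isDiag_posDef hM hM'
      obtain ⟨w, hw, rfl⟩ := exists_diagonal_of_isDiag_posDef hW hW'
      exact ⟨m, w, hm, hw, (key m w).1 hx, h0⟩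
    · rintro ⟨m, w, hm, hw, hx, h0⟩
      exact ⟨Matrix.diagonal m, Matrix.diagonal w,
        ⟨Matrix.isDiag_diagonal m, Matrix.posDef_diagonal_iff.2 hm⟩,
        ⟨Matrix.isDiag_diagonal w, Matrix.posDef_diagonal_iff.2 hw⟩, (key m w).2 hx, h0⟩
  constructor
  · intro h m w x hm hw hx h0
    have : x ∈ kernelUnion B Vd := (hmem x).2 ⟨m, w, hm, hw, hx, h0⟩
    rwa [h] at this
  · intro h
    ext x
    rw [Set.mem_singleton_iff, hmem]
    constructor
    · rintro ⟨m, w, hm, hw, hx, h0⟩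
      exact h m w x hm hw hx h0
    · rintro rfl
      exact ⟨1, 1, fun _ => one_pos, fun _ => one_pos, fun i => by simp [lap], fun _ _ => rfl⟩

/-- At a zero of `x`, the equation `L x = M x` says that a positive combination of the values at the
neighbors vanishes, so positive neighbors occur exactly when negative ones do. -/
lemma zeroBalanced_of_lap_eq {V : Type*} [Fintype V] [DecidableEq V] {G : SimpleGraph V}
    [DecidableRel G.Adj] {B : Matrix V G.edgeSet ℝ} (hB : IsOrientedIncidence G B) {Vd : Set V}
    {m : V → ℝ} {w : G.edgeSet → ℝ} (hw : ∀ e, 0 < w e) {x : V → ℝ} (hx : ∀ i, lap B w x i = m i * x i)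
    (h0 : ∀ i ∈ Vd, x i = 0) : ZeroBalanced G Vd x := by
  refine ⟨h0, fun i hi => ?_⟩
  have hsum := hx i
  rw [hB.lap_apply, hi, mul_zero] at hsum
  simp only [zero_sub, mul_neg, Finset.sum_neg_distrib, neg_eq_zero] at hsum
  -- A neighbor whose value has one strict sign forces a neighbor of the other sign, for `x` and
  -- for `-x`.
  have key : ∀ y : V → ℝ, (∑ j, (if h : G.Adj i j then w ⟨s(i, j), h⟩ else 0) * y j = 0) →
      (∃ j, G.Adj i j ∧ y j < 0) → ∃ k, G.Adj i k ∧ 0 < y k := by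
    rintro y hy ⟨j, hij, hj⟩
    by_contra! hall
    refine absurd hy (ne_of_lt (Finset.sum_neg' (fun k _ => ?_) ⟨j, Finset.mem_univ j, ?_⟩))
    · by_cases hik : G.Adj i k
      · rw [dif_pos hik]
        exact mul_nonpos_of_nonneg_of_nonpos (hw _).le (hall k hik)
      · simp [hik]
    · rw [dif_pos hij]
      exact mul_neg_of_pos_of_neg (hw _) hj
  constructor
  · exact key x hsum
  · have := key (fun j => -x j) (by
      simp only [mul_neg, Finset.sum_neg_distrib, hsum, neg_zero])
    simpa using this

lemma exists_adj_dist_add_one_eq {V : Type*} {G : SimpleGraph V} (hG : G.Connected) (v : V)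
    {i : V} (hi : i ≠ v) :
    ∃ j, G.Adj i j ∧ G.dist j v + 1 = G.dist i v := by
  obtain ⟨p, hp⟩ := hG.exists_walk_length_eq_dist i v
  cases p with
  | nil => exact absurd rfl hi
  | @cons _ j _ hij q =>
    refine ⟨j, hij, ?_⟩
    have h1 := SimpleGraph.dist_le q
    have h2 := hG.dist_triangle (u := i) (v := j) (w := v)
    rw [SimpleGraph.dist_eq_one_iff_adj.2 hij] at h2
    rw [SimpleGraph.Walk.length_cons] at hp
    omega

section
variable {V : Type*} [Fintype V] {G : SimpleGraph V} [DecidableRel G.Adj]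

/-- The number of neighbors of `i` at which the sign vector `x` takes the value `s`. -/
def signCount (G : SimpleGraph V) [DecidableRel G.Adj] (x : V → SignType) (i : V) (s : SignType) :
    ℕ :=
  (Finset.univ.filter fun j => G.Adj i j ∧ x j = s).card

/-- Edge weights adapted to a sign vector `x` and to a modulus `g`. Every edge from a zero `i` of
`x` to a node `j` where `x` is not zero has a weight inversely proportional to `g j` and to the
number of neighbors of `i` with the sign of `j`, so that the positive neighbors of `i` contribute to
the weighted sum of `x * g` as much as the negative ones; all other weights are `1`. -/
noncomputable def balancingWeight (G : SimpleGraph V) [DecidableRel G.Adj] (x : V → SignType)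
    (g : V → ℝ) (i j : V) : ℝ :=
  if x i = 0 then
    if x j = 0 then 1 else Fintype.card V / (g j * signCount G x i (x j))
  else if x j = 0 then Fintype.card V / (g i * signCount G x j (x i)) else 1

lemma balancingWeight_comm (x : V → SignType) (g : V → ℝ) (i j : V) :
    balancingWeight G x g i j = balancingWeight G x g j i := by
  unfold balancingWeight
  split_ifs <;> rfl

lemma signCount_pos {x : V → SignType} {i j : V} (h : G.Adj i j) : 0 < signCount G x i (x j) :=
  Finset.card_pos.2 ⟨j, by simp [h]⟩

lemma signCount_le (x : V → SignType) (i : V) (s : SignType) :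
    signCount G x i s ≤ Fintype.card V :=
  Finset.card_le_univ _

lemma balancingWeight_pos (x : V → SignType) {g : V → ℝ} (hg : ∀ i, 0 < g i) {i j : V}
    (h : G.Adj i j) : 0 < balancingWeight G x g i j := by
  have hV : (0 : ℝ) < Fintype.card V := by
    exact_mod_cast Fintype.card_pos_iff.2 ⟨i⟩
  have h1 : (0 : ℝ) < signCount G x i (x j) := by exact_mod_cast signCount_pos h
  have h2 : (0 : ℝ) < signCount G x j (x i) := by exact_mod_cast signCount_pos h.symm
  have := hg i
  have := hg j
  unfold balancingWeight
  split_ifs <;> positivity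

/-- At a zero of a balanced sign vector `x`, the balancing weights make the contributions of
positive and negative neighbors cancel. -/
lemma sum_balancingWeight_eq_zero {Vd : Set V} {x : V → SignType} (hx : ZeroBalanced G Vd x)
    {g : V → ℝ} (hg : ∀ i, 0 < g i) {i : V} (hi : x i = 0) :
    ∑ j, (if G.Adj i j then balancingWeight G x g i j else 0) * ((x j : ℝ) * g j) = 0 := by
  have hsplit : ∀ j, (if G.Adj i j then balancingWeight G x g i j else 0) * ((x j : ℝ) * g j) =
      (if G.Adj i j ∧ x j = 1 then (Fintype.card V : ℝ) / signCount G x i 1 else 0) -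
        (if G.Adj i j ∧ x j = -1 then (Fintype.card V : ℝ) / signCount G x i (-1) else 0) := by
    intro j
    by_cases hij : G.Adj i j
    · have h1 : (signCount G x i (x j) : ℝ) ≠ 0 := by exact_mod_cast (signCount_pos hij).ne'
      have h2 := (hg j).ne'
      rcases hxj : x j with _ | _ | _
      · simp
      all_goals
        rw [hxj] at h1
        simp only [SignType.neg_eq_neg_one, SignType.pos_eq_one] at h1
        simp [hij, balancingWeight, hi, hxj]
        field_simp
    · simp [hij]
  have hcount : ∀ s, ∑ j, (if G.Adj i j ∧ x j = s then
      (Fintype.card V : ℝ) / signCount G x i s else 0) =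
        if ∃ j, G.Adj i j ∧ x j = s then (Fintype.card V : ℝ) else 0 := by
    intro s
    rw [← Finset.sum_filter, Finset.sum_const, nsmul_eq_mul]
    split_ifs with h
    · obtain ⟨j, hj, rfl⟩ := h
      have h1 : (signCount G x i (x j) : ℝ) ≠ 0 := by exact_mod_cast (signCount_pos hj).ne'
      change (signCount G x i (x j) : ℝ) * _ = _
      field_simp
    · have : (Finset.univ.filter fun j => G.Adj i j ∧ x j = s) = ∅ := by
        simpa [Finset.filter_eq_empty_iff] using h
      simp [this]
  have hiff := hx.2 i hi
  simp only [SignType.neg_iff, SignType.pos_iff] at hiff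
  simp only [hsplit, Finset.sum_sub_distrib, hcount, sub_eq_zero, hiff]

end

/-- The modulus `2 - ε ^ d` of the distance `d` to a node `v`, with `ε = 1 / (|V| + 1)`: its
increments `ε ^ d * (1 - ε)` decrease so fast that one neighbor closer to `v` outweighs all
neighbors farther from `v`. -/
noncomputable def modulus {V : Type*} [Fintype V] (G : SimpleGraph V) (v i : V) : ℝ :=
  2 - (1 / (Fintype.card V + 1 : ℝ)) ^ G.dist i v

lemma one_le_modulus {V : Type*} [Fintype V] (G : SimpleGraph V) (v i : V) :
    1 ≤ modulus G v i := by
  have h : (1 / (Fintype.card V + 1 : ℝ)) ^ G.dist i v ≤ 1 :=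
    pow_le_one₀ (by positivity) ((div_le_one (by positivity)).2 (by simp))
  unfold modulus
  linarith

/-- With the balancing weights and the modulus of the distance to a zero of `x`, the vector
`x * modulus` is strictly subharmonic where it is negative and strictly superharmonic where it is
positive. -/
lemma sum_balancingWeight_pos {V : Type*} [Fintype V] {G : SimpleGraph V} [DecidableRel G.Adj]
    (hG : G.Connected) {x : V → SignType} {v i : V} (hv : x v = 0) (hi : x i ≠ 0) :
    0 < (x i : ℝ) * ∑ j, (if G.Adj i j then balancingWeight G x (modulus G v) i j else 0) *
      ((x i : ℝ) * modulus G v i - (x j : ℝ) * modulus G v j) := by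
  classical
  set g := modulus G v with hg
  have hg1 : ∀ j, 1 ≤ g j := one_le_modulus G v
  obtain ⟨k, hik, hk⟩ := exists_adj_dist_add_one_eq hG v (i := i) (by rintro rfl; exact hi hv)
  set ε : ℝ := 1 / (Fintype.card V + 1 : ℝ) with hε
  have hε0 : 0 < ε := by positivity
  have hn : (Fintype.card V : ℝ) * ε = 1 - ε := by
    rw [hε]
    field_simp
    ring
  have hn1 : (1 : ℝ) ≤ Fintype.card V := by
    exact_mod_cast Fintype.card_pos_iff.2 ⟨i⟩
  have hε1 : ε ≤ 1 := by nlinarith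
  set η : ℝ := ε ^ G.dist k v * (1 - ε) with hη
  have hη0 : 0 < η := by
    have : 0 < 1 - ε := by rw [← hn]; positivity
    positivity
  have hη1 : η ≤ 1 := mul_le_one₀ (pow_le_one₀ hε0.le hε1) (by rw [← hn]; positivity) (by linarith)
  -- The term of the neighbor `k` is at least `η`, and each of the others at least `-ε * η`.
  have hadj : ∀ j, G.Adj i j → (η ≤ g i - g j ∨ (j ≠ k ∧ -(ε * η) ≤ g i - g j)) := by
    intro j hij
    by_cases hjk : j = k
    · left
      subst hjk
      simp only [hg, modulus, ← hε, hη, ← hk, pow_succ]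
      linarith
    · right
      refine ⟨hjk, ?_⟩
      have hd : G.dist j v ≤ G.dist k v + 2 := by
        have := hG.dist_triangle (u := j) (v := i) (w := v)
        rw [SimpleGraph.dist_eq_one_iff_adj.2 hij.symm] at this
        omega
      have hp := pow_le_pow_of_le_one hε0.le hε1 hd
      simp only [hg, modulus, ← hε, hη, ← hk, pow_succ] at hp ⊢
      linarith
  have hterm : ∀ j, -(ε * η) + (if j = k then η else 0) ≤
      (x i : ℝ) * ((if G.Adj i j then balancingWeight G x g i j else 0) *
        ((x i : ℝ) * g i - (x j : ℝ) * g j)) := by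
    intro j
    have hεη : 0 ≤ ε * η := by positivity
    have hle : -(ε * η) + (if j = k then η else 0) ≤ 1 := by split_ifs <;> linarith
    by_cases hij : G.Adj i j
    · rw [if_pos hij]
      have hxi : (x i : ℝ) * (x i : ℝ) = 1 := by
        revert hi
        rcases x i with _ | _ | _ <;> simp
      have hs : ∀ c, (x i : ℝ) * (c * ((x i : ℝ) * g i - (x j : ℝ) * g j)) =
          c * (g i - (x i : ℝ) * (x j : ℝ) * g j) := by
        intro c
        linear_combination c * g i * hxi
      rw [hs]
      by_cases hj : x j = 0
      · refine hle.trans ?_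
        have h1 : (0 : ℝ) < signCount G x j (x i) := by exact_mod_cast signCount_pos hij.symm
        have h2 : (signCount G x j (x i) : ℝ) ≤ Fintype.card V := by
          exact_mod_cast signCount_le x j (x i)
        have h3 : g i ≠ 0 := by linarith [hg1 i]
        simp only [balancingWeight, hi, hj, if_true, if_false, SignType.coe_zero, mul_zero,
          zero_mul, sub_zero]
        rw [div_mul_eq_mul_div, mul_comm, mul_div_mul_left _ _ h3]
        exact (one_le_div h1).2 h2
      · simp only [balancingWeight, hi, hj, if_false, one_mul]
        have hcases : (x i : ℝ) * (x j : ℝ) = 1 ∨ (x i : ℝ) * (x j : ℝ) = -1 := by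
          revert hi hj
          rcases x i with _ | _ | _ <;> rcases x j with _ | _ | _ <;> simp
        rcases hcases with h | h
        · rw [h, one_mul]
          rcases hadj j hij with h' | ⟨hjk, h'⟩
          · split_ifs <;> linarith
          · rw [if_neg hjk]
            linarith
        · rw [h]
          linarith [hg1 i, hg1 j]
    · have hjk : j ≠ k := by
        rintro rfl
        exact hij hik
      simp only [if_neg hij, if_neg hjk, zero_mul, mul_zero]
      linarith
  rw [Finset.mul_sum]
  refine lt_of_lt_of_le ?_ (Finset.sum_le_sum fun j _ => hterm j)
  rw [Finset.sum_add_distrib, Finset.sum_const, Finset.sum_ite_eq' Finset.univ k,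
    if_pos (Finset.mem_univ k), nsmul_eq_mul, Finset.card_univ]
  have : (Fintype.card V : ℝ) * -(ε * η) = -((1 - ε) * η) := by rw [← hn]; ring
  rw [this]
  nlinarith

/-- Every balanced sign vector that vanishes somewhere is the sign pattern of a vector in the kernel
of `L - M`, for suitable edge weights and masses. -/
lemma exists_lap_eq_of_zeroBalanced {V : Type*} [Fintype V] [DecidableEq V] {G : SimpleGraph V}
    [DecidableRel G.Adj] {B : Matrix V G.edgeSet ℝ} (hB : IsOrientedIncidence G B)
    (hG : G.Connected) {Vd : Set V} (hVd : Vd.Nonempty) {x : V → SignType} (hx0 : x ≠ 0)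
    (hx : ZeroBalanced G Vd x) :
    ∃ (m : V → ℝ) (w : G.edgeSet → ℝ) (y : V → ℝ), (∀ i, 0 < m i) ∧ (∀ e, 0 < w e) ∧
      (∀ i, lap B w y i = m i * y i) ∧ (∀ i ∈ Vd, y i = 0) ∧ y ≠ 0 := by
  obtain ⟨v, hv⟩ := hVd
  set g := modulus G v with hg
  have hg0 : ∀ i, 0 < g i := fun i => one_pos.trans_le (one_le_modulus G v i)
  let w : G.edgeSet → ℝ := fun e =>
    Sym2.lift ⟨balancingWeight G x g, balancingWeight_comm x g⟩ (e : Sym2 V)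
  have hw : ∀ e, 0 < w e := by
    rintro ⟨e, he⟩
    induction e using Sym2.ind with
    | _ i j => exact balancingWeight_pos x hg0 he
  let y : V → ℝ := fun i => (x i : ℝ) * g i
  have hy : ∀ i, y i = 0 ↔ x i = 0 := by
    intro i
    have : ((x i : ℝ) = 0) ↔ x i = 0 := by
      rcases x i with _ | _ | _ <;> simp
    simp [y, (hg0 i).ne', this]
  have hlap : ∀ i, lap B w y i =
      ∑ j, (if G.Adj i j then balancingWeight G x g i j else 0) * (y i - y j) := by
    intro i
    rw [hB.lap_apply]
    refine Finset.sum_congr rfl fun j _ => ?_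
    by_cases h : G.Adj i j
    · simp [h, w]
    · simp [h]
  refine ⟨fun i => if x i = 0 then 1 else lap B w y i / y i, w, y, fun i => ?_, hw, fun i => ?_,
    fun i hi => (hy i).2 (hx.1 i hi), ?_⟩
  · dsimp only
    split_ifs with hi
    · exact one_pos
    · have h1 := sum_balancingWeight_pos hG (hx.1 v hv) hi
      rw [← hg, ← hlap i] at h1
      have h2 : 0 < lap B w y i * y i := by
        have := mul_pos h1 (hg0 i)
        simp only [y] at this ⊢
        linarith
      have h3 : y i ≠ 0 := fun h => hi ((hy i).1 h)
      rw [← mul_div_mul_right _ _ h3]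
      exact div_pos h2 (mul_self_pos.2 h3)
  · dsimp only
    split_ifs with hi
    · rw [hlap, (hy i).2 hi, mul_zero]
      simp only [zero_sub, mul_neg, Finset.sum_neg_distrib, neg_eq_zero]
      exact sum_balancingWeight_eq_zero hx hg0 hi
    · rw [div_mul_cancel₀]
      exact fun h => hi ((hy i).1 h)
  · obtain ⟨i, hi⟩ := Function.ne_iff.1 hx0
    exact Function.ne_iff.2 ⟨i, fun h => hi ((hy i).1 h)⟩

end MassSpring

/-! ### Invariance principle for linear systems -/

namespace MassSpring

open Filter NormedSpace

/-- Lyapunov stability of the origin for a continuous energy that dominates the squared norm. -/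
lemma stable_of_energy {E : Type*} [NormedAddCommGroup E] {Φ : ℝ → E → E} {H : E → ℝ}
    (hc : Continuous H) (h0 : H 0 = 0) {c : ℝ} (hc0 : 0 < c) (hbound : ∀ z, c * ‖z‖ ^ 2 ≤ H z)
    (hmono : ∀ z t, 0 ≤ t → H (Φ t z) ≤ H z) {ε : ℝ} (hε : 0 < ε) :
    ∃ δ, 0 < δ ∧ ∀ z, ‖z‖ < δ → ∀ t, 0 ≤ t → ‖Φ t z‖ < ε := by
  have h1 : ∀ᶠ z in 𝓝 (0 : E), H z < c * ε ^ 2 :=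
    hc.continuousAt.eventually_lt continuousAt_const (by rw [h0]; positivity)
  obtain ⟨δ, hδ, h⟩ := Metric.eventually_nhds_iff.1 h1
  refine ⟨δ, hδ, fun z hz t ht => ?_⟩
  have h2 := (hbound (Φ t z)).trans_lt ((hmono z t ht).trans_lt (h (by simpa using hz)))
  exact lt_of_pow_lt_pow_left₀ 2 hε.le (lt_of_mul_lt_mul_left h2 hc0.le)

section
variable {E F : Type*} [NormedAddCommGroup E] [NormedSpace ℝ E] [FiniteDimensional ℝ E]
  [NormedAddCommGroup F] [NormedSpace ℝ F]

lemma hasDerivAt_exp_smul_apply (A : E →L[ℝ] E) (z : E) (t : ℝ) :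
    HasDerivAt (fun t : ℝ => exp (t • A) z) (A (exp (t • A) z)) t := by
  have := FiniteDimensional.complete ℝ E
  exact (hasDerivAt_exp_smul_const' A t).clm_apply (hasDerivAt_const t z) |>.congr_deriv (by simp)

/-- The only solution of a linear differential equation is the matrix exponential. -/
lemma eq_exp_smul_apply (A : E →L[ℝ] E) {z : ℝ → E}
    (hz : ∀ t, 0 ≤ t → HasDerivWithinAt z (A (z t)) (Set.Ici 0) t) {t : ℝ} (ht : 0 ≤ t) :
    z t = exp (t • A) (z 0) := by
  have h : Set.EqOn z (fun t => exp (t • A) (z 0)) (Set.Icc 0 t) := by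
    refine ODE_solution_unique (v := fun _ => A) (K := ‖A‖₊) (fun _ => A.lipschitz) ?_ ?_ ?_ ?_ ?_
    · exact fun s hs => ((hz s hs.1).continuousWithinAt).mono fun _ h => h.1
    · exact fun s hs => (hz s hs.1).mono fun _ h => hs.1.trans h
    · exact fun s _ => (hasDerivAt_exp_smul_apply A _ s).continuousAt.continuousWithinAt
    · exact fun s _ => (hasDerivAt_exp_smul_apply A _ s).hasDerivWithinAt
    · simp
  exact h ⟨ht, le_rfl⟩

lemma exp_smul_apply_add (A : E →L[ℝ] E) (z : E) (s t : ℝ) :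
    exp ((s + t) • A) z = exp (s • A) (exp (t • A) z) := by
  have := FiniteDimensional.complete ℝ E
  let _ : NormedAlgebra ℚ (E →L[ℝ] E) := NormedAlgebra.restrictScalars ℚ ℝ _
  rw [add_smul, exp_add_of_commute ((Commute.refl A).smul_left s |>.smul_right t)]
  rfl

/-- A subspace that contains the range of `A` is invariant under the flow of `A`. -/
lemma exp_smul_apply_mem (A : E →L[ℝ] E) {S : Submodule ℝ E} (hS : ∀ z, A z ∈ S) {z : E}
    (hz : z ∈ S) (t : ℝ) : exp (t • A) z ∈ S := by
  have := FiniteDimensional.complete ℝ E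
  have h := (exp_series_hasSum_exp' (𝕂 := ℝ) (t • A)).mapL
    (ContinuousLinearMap.apply ℝ E z)
  refine S.closed_of_finiteDimensional.mem_of_tendsto h (Eventually.of_forall fun s => ?_)
  refine S.sum_mem fun n _ => ?_
  cases n with
  | zero => simpa using hz
  | succ n =>
    rw [pow_succ']
    exact S.smul_mem _ (S.smul_mem _ (hS _))

/-- The unobservable states of an output `C` are invariant under `A`. -/
lemma unobservable_apply (A : E →L[ℝ] E) (C : E →L[ℝ] F) {z : E}
    (h : ∀ t : ℝ, 0 ≤ t → C (exp (t • A) z) = 0) {t : ℝ} (ht : 0 ≤ t) :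
    C (exp (t • A) (A z)) = 0 := by
  have hcomm : exp (t • A) (A z) = A (exp (t • A) z) := by
    have := FiniteDimensional.complete ℝ E
    have : Commute (exp (t • A)) A := ((Commute.refl A).smul_left t).exp_left
    exact congrArg (fun B : E →L[ℝ] E => B z) this.eq
  have h1 : HasDerivWithinAt (fun t : ℝ => C (exp (t • A) z)) (C (A (exp (t • A) z)))
      (Set.Ici 0) t :=
    (C.hasFDerivAt.comp_hasDerivAt t (hasDerivAt_exp_smul_apply A z t)).hasDerivWithinAt
  have h2 : HasDerivWithinAt (fun t : ℝ => C (exp (t • A) z)) 0 (Set.Ici 0) t :=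
    (hasDerivWithinAt_const t _ (0 : F)).congr (fun s hs => h s hs) (h t ht)
  rw [hcomm]
  exact (uniqueDiffOn_Ici (0 : ℝ) t ht).eq_deriv _ h1 h2

/-- A continuous positive definite function that is homogeneous of degree two dominates a multiple of
the squared norm. -/
lemma exists_mul_sq_norm_le {H : E → ℝ} (hc : Continuous H)
    (hsmul : ∀ (a : ℝ) z, H (a • z) = a ^ 2 * H z) (hpos : ∀ z, z ≠ 0 → 0 < H z) :
    ∃ c, 0 < c ∧ ∀ z, c * ‖z‖ ^ 2 ≤ H z := by
  have := FiniteDimensional.proper ℝ E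
  have h0 : H 0 = 0 := by simpa using hsmul 0 0
  rcases (Metric.sphere (0 : E) 1).eq_empty_or_nonempty with he | hne
  · refine ⟨1, one_pos, fun z => ?_⟩
    by_cases hz : z = 0
    · simp [hz, h0]
    · have : ‖z‖⁻¹ • z ∈ Metric.sphere (0 : E) 1 := by simp [norm_smul, hz]
      simp [he] at this
  · obtain ⟨u, hu, hmin⟩ := (isCompact_sphere (0 : E) 1).exists_isMinOn hne hc.continuousOn
    refine ⟨H u, hpos u (by rintro rfl; simp at hu), fun z => ?_⟩
    by_cases hz : z = 0
    · simp [hz, h0]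
    · have h1 : H u ≤ H (‖z‖⁻¹ • z) :=
        hmin (show _ ∈ Metric.sphere (0 : E) 1 by simp [norm_smul, hz])
      rw [hsmul, inv_pow, ← div_eq_inv_mul, le_div_iff₀ (by positivity)] at h1
      exact h1

/-- LaSalle's invariance principle for a linear system: along a limit point of the trajectory the
energy is constant, so the limit point is the origin, and the energy decreases to zero. -/
lemma tendsto_zero_of_energy (A : E →L[ℝ] E) {H : E → ℝ}
    (hc : Continuous H) (h0 : H 0 = 0) {c : ℝ} (hc0 : 0 < c) (hbound : ∀ z, c * ‖z‖ ^ 2 ≤ H z)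
    (hmono : ∀ z (t : ℝ), 0 ≤ t → H (exp (t • A) z) ≤ H z) {S : Submodule ℝ E}
    (hS : ∀ z ∈ S, ∀ t : ℝ, exp (t • A) z ∈ S)
    (hobs : ∀ z ∈ S, (∀ t : ℝ, 0 ≤ t → H (exp (t • A) z) = H z) → z = 0) {z : E} (hz : z ∈ S) :
    Tendsto (fun t : ℝ => exp (t • A) z) atTop (𝓝 0) := by
  have := FiniteDimensional.proper ℝ E
  have hnn : ∀ y, 0 ≤ H y := fun y => le_trans (by positivity) (hbound y)
  have hanti : Antitone fun t : ℝ => H (exp (t • A) z) := by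
    intro s t hst
    have h1 := hmono (exp (s • A) z) (t - s) (sub_nonneg.2 hst)
    rwa [← exp_smul_apply_add, sub_add_cancel] at h1
  obtain ⟨ℓ, hℓ⟩ : ∃ ℓ, Tendsto (fun t : ℝ => H (exp (t • A) z)) atTop (𝓝 ℓ) :=
    ⟨_, tendsto_atTop_ciInf hanti ⟨0, by rintro _ ⟨t, rfl⟩; exact hnn _⟩⟩
  have hball : ∀ n : ℕ, exp ((n : ℝ) • A) z ∈ Metric.closedBall (0 : E) (Real.sqrt (H z / c)) := by
    intro n
    rw [mem_closedBall_zero_iff]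
    refine Real.le_sqrt_of_sq_le ?_
    rw [le_div_iff₀ hc0, mul_comm]
    exact (hbound _).trans (hmono z n n.cast_nonneg)
  obtain ⟨y, -, φ, hφ, hy⟩ := (isCompact_closedBall _ _).tendsto_subseq hball
  have hyS : y ∈ S := S.closed_of_finiteDimensional.mem_of_tendsto hy
    (Eventually.of_forall fun n => hS z hz _)
  have hyℓ : ∀ t : ℝ, H (exp (t • A) y) = ℓ := by
    intro t
    have h1 : Tendsto (fun n => H (exp (t • A) (exp ((φ n : ℝ) • A) z))) atTop
        (𝓝 (H (exp (t • A) y))) :=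
      ((hc.comp (exp (t • A)).continuous).tendsto y).comp hy
    have h2 : Tendsto (fun n => H (exp (t • A) (exp ((φ n : ℝ) • A) z))) atTop (𝓝 ℓ) := by
      simp only [← exp_smul_apply_add]
      exact hℓ.comp (tendsto_atTop_add_const_left _ t
        (tendsto_natCast_atTop_atTop.comp hφ.tendsto_atTop))
    exact tendsto_nhds_unique h1 h2
  have hy0 : y = 0 := hobs y hyS fun t _ => by rw [hyℓ t, ← hyℓ 0]; simp
  have hℓ0 : ℓ = 0 := by
    rw [← hyℓ 0, hy0]
    simpa using h0
  rw [hℓ0] at hℓ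
  have hsq : Tendsto (fun t : ℝ => ‖exp (t • A) z‖ ^ 2) atTop (𝓝 0) := by
    refine squeeze_zero (fun t => by positivity) (g := fun t : ℝ => H (exp (t • A) z) / c)
      (fun t => ?_) (by simpa using hℓ.div_const c)
    rw [le_div_iff₀ hc0, mul_comm]
    exact hbound _
  rw [tendsto_zero_iff_norm_tendsto_zero]
  simpa [Real.sqrt_sq (norm_nonneg _)] using hsq.sqrt

end

end MassSpring

/-! ### Unobservable modes of a scalar network -/

namespace MassSpring

open NormedSpace

/-- A subspace of vectors that vanish on the damped nodes and that is invariant under `M⁻¹ L` is zero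
if the kernel condition holds. In the coordinates `√mᵢ xᵢ` the operator is symmetric, so it has an
eigenvector in the subspace; a positive eigenvalue contradicts the kernel condition, and the other
eigenvalues have constant eigenvectors. -/
lemma eq_zero_of_invariant {V : Type*} [Fintype V] {G : SimpleGraph V} [Fintype G.edgeSet]
    (hG : G.Connected) {Vd : Set V} (hVd : Vd.Nonempty) {B : Matrix V G.edgeSet ℝ}
    (hB : IsOrientedIncidence G B)
    (hker : ∀ (m : V → ℝ) (w : G.edgeSet → ℝ) (x : V → ℝ), (∀ i, 0 < m i) →
      (∀ e, 0 < w e) → (∀ i, lap B w x i = m i * x i) → (∀ i ∈ Vd, x i = 0) → x = 0)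
    {m : V → ℝ} {w : G.edgeSet → ℝ} (hm : ∀ i, 0 < m i) (hw : ∀ e, 0 < w e)
    {S : Submodule ℝ (V → ℝ)} (hS : ∀ y ∈ S, ∀ i ∈ Vd, y i = 0)
    (hinv : ∀ y ∈ S, (fun i => lap B w y i / m i) ∈ S) {y : V → ℝ} (hy : y ∈ S) : y = 0 := by
  have hsq : ∀ i, Real.sqrt (m i) ≠ 0 := fun i => (Real.sqrt_pos.2 (hm i)).ne'
  have hsq2 : ∀ i, Real.sqrt (m i) * Real.sqrt (m i) = m i := fun i => Real.mul_self_sqrt (hm i).le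
  let φ : EuclideanSpace ℝ V →ₗ[ℝ] (V → ℝ) :=
    { toFun := fun u i => u i / Real.sqrt (m i)
      map_add' := fun u v => by
        funext i
        simp [add_div]
      map_smul' := fun a u => by
        funext i
        simp [mul_div_assoc] }
  have hφ : ∀ u i, φ u i = u i / Real.sqrt (m i) := fun _ _ => rfl
  let T : EuclideanSpace ℝ V →ₗ[ℝ] EuclideanSpace ℝ V :=
    { toFun := fun u => WithLp.toLp 2 fun i => lap B w (φ u) i / Real.sqrt (m i)
      map_add' := fun u v => by
        ext i
        simp [lap_add, add_div]
      map_smul' := fun a u => by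
        ext i
        simp [lap_smul, mul_div_assoc] }
  have hT : ∀ u i, T u i = lap B w (φ u) i / Real.sqrt (m i) := fun _ _ => rfl
  have hTsymm : T.IsSymmetric := by
    intro u v
    simp only [PiLp.inner_apply, RCLike.inner_apply, conj_trivial, hT]
    have h1 := sum_mul_lap_comm B w (φ u) (φ v)
    calc ∑ i, v i * (lap B w (φ u) i / Real.sqrt (m i)) = ∑ i, lap B w (φ u) i * φ v i :=
          Finset.sum_congr rfl fun i _ => by rw [hφ]; ring
      _ = ∑ i, φ u i * lap B w (φ v) i := h1
      _ = ∑ i, lap B w (φ v) i / Real.sqrt (m i) * u i :=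
          Finset.sum_congr rfl fun i _ => by rw [hφ]; ring
  have hTS : ∀ u ∈ S.comap φ, T u ∈ S.comap φ := by
    intro u hu
    have h1 := hinv _ hu
    have h2 : φ (T u) = fun i => lap B w (φ u) i / m i := by
      funext i
      rw [hφ, hT, div_div, hsq2]
    rwa [Submodule.mem_comap, h2]
  have hbot : S.comap φ = ⊥ := by
    by_contra hne
    have : Nontrivial (S.comap φ) := Submodule.nontrivial_iff_ne_bot.2 hne
    obtain ⟨⟨u, hu⟩, hev⟩ := 
      (hTsymm.restrict_invariant hTS).hasEigenvalue_iSup_of_finiteDimensional.exists_hasEigenvector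
    obtain ⟨lam, hlam⟩ : ∃ lam : ℝ, T u = lam • u := ⟨_, congrArg Subtype.val hev.apply_eq_smul⟩
    have hu0 : u ≠ 0 := fun h => hev.2 (Subtype.ext h)
    have hx : ∀ i, lap B w (φ u) i = lam * m i * φ u i := by
      intro i
      have h1 : T u i = lam * u i := by rw [hlam]; rfl
      rw [hT, div_eq_iff (hsq i)] at h1
      rw [h1, hφ, mul_div_assoc', eq_div_iff (hsq i), mul_assoc _ _ (Real.sqrt (m i)), hsq2]
      ring
    refine hu0 ?_
    have hφ0 : φ u = 0 := by
      rcases lt_or_ge 0 lam with hpos | hneg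
      · exact hker (fun i => lam * m i) w _ (fun i => mul_pos hpos (hm i)) hw hx (hS _ hu)
      · have h1 : ∑ i, φ u i * lap B w (φ u) i ≤ 0 := by
          refine Finset.sum_nonpos fun i _ => ?_
          rw [hx]
          have := mul_nonneg (hm i).le (mul_self_nonneg (φ u i))
          nlinarith
        have hc := hB.eq_of_edge_eq_zero hG (edge_eq_zero_of_sum_mul_lap_self B hw
          (h1.antisymm (sum_mul_lap_self_nonneg B hw _)))
        obtain ⟨v, hv⟩ := hVd
        funext i
        rw [hc i v]
        exact hS _ hu v hv
    ext i
    have := congrFun hφ0 i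
    rw [hφ] at this
    simpa [hsq i] using this
  have hu : WithLp.toLp 2 (fun i => y i * Real.sqrt (m i)) ∈ S.comap φ := by
    rw [Submodule.mem_comap]
    convert hy using 1
    funext i
    rw [hφ]
    exact mul_div_cancel_right₀ _ (hsq i)
  rw [hbot, Submodule.mem_bot] at hu
  funext i
  have := congrArg (fun u : EuclideanSpace ℝ V => u i) hu
  simpa [hsq i] using this

end MassSpring

/-! ### The network as a linear system -/

namespace MassSpring

open NormedSpace

section
variable {V E : Type*} {r : ℕ} {P : Params V E r} {m : V → Fin r → ℝ} {w : E → Fin r → ℝ}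

lemma Params.Feasible.exists_diagonal {Vd : Set V} (hP : P.Feasible Vd) :
    ∃ (m : V → Fin r → ℝ) (w : E → Fin r → ℝ), (∀ i k, 0 < m i k) ∧ (∀ e k, 0 < w e k) ∧
      (∀ i, P.M i = Matrix.diagonal (m i)) ∧ ∀ e, P.W e = Matrix.diagonal (w e) := by
  choose m hm hM using fun i => exists_diagonal_of_isDiag_posDef (hP.1 i).1 (hP.1 i).2
  choose w hw hW using fun e => exists_diagonal_of_isDiag_posDef (hP.2.1 e).1 (hP.2.1 e).2
  exact ⟨m, w, hm, hw, hM, hW⟩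

lemma output_apply (hm : ∀ i k, 0 < m i k) (hM : ∀ i, P.M i = Matrix.diagonal (m i))
    (z : State V E r) (i : V) (k : Fin r) : output P z i k = z.1 i k / m i k := by
  have h : (Matrix.diagonal (m i))⁻¹ = Matrix.diagonal fun k => (m i k)⁻¹ := by
    refine Matrix.inv_eq_left_inv ?_
    rw [Matrix.diagonal_mul_diagonal, ← Matrix.diagonal_one]
    congr 1
    funext k
    exact inv_mul_cancel₀ (hm i k).ne'
  rw [output, hM, h, Matrix.mulVec_diagonal, div_eq_inv_mul]

variable [Fintype V] [Fintype E] (B : Matrix V E ℝ)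

lemma vectorField_fst_apply (hW : ∀ e, P.W e = Matrix.diagonal (w e)) (v : V → Fin r → ℝ)
    (z : State V E r) (i : V) (k : Fin r) :
    (vectorField B P v z).1 i k =
      -(P.R i *ᵥ output P z i) k - ∑ e, B i e * (w e k * z.2 e k) + v i k := by
  simp [vectorField, hW, Matrix.mulVec_diagonal, Finset.sum_apply]

lemma vectorField_snd_apply (v : V → Fin r → ℝ) (z : State V E r) (e : E) (k : Fin r) :
    (vectorField B P v z).2 e k = ∑ i, B i e * output P z i k := by
  simp [vectorField, Finset.sum_apply]

lemma vectorField_eq_add (v : V → Fin r → ℝ) (z : State V E r) :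
    vectorField B P v z = vectorField B P 0 z + (v, 0) := by
  ext <;> simp [vectorField]

/-- The output as a linear map. -/
noncomputable def outputL (P : Params V E r) : State V E r →L[ℝ] (V → Fin r → ℝ) :=
  LinearMap.toContinuousLinearMap
    { toFun := output P
      map_add' := fun z z' => by
        funext i
        simp [output, Matrix.mulVec_add]
      map_smul' := fun a z => by
        funext i
        simp [output, Matrix.mulVec_smul] }

lemma outputL_apply (z : State V E r) : outputL P z = output P z := rfl

/-- The vector field without external input as a linear map. -/
noncomputable def systemL (B : Matrix V E ℝ) (P : Params V E r) :
    State V E r →L[ℝ] State V E r :=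
  LinearMap.toContinuousLinearMap
    { toFun := vectorField B P 0
      map_add' := fun z z' => by
        have h : output P (z + z') = output P z + output P z' := map_add (outputL P) z z'
        refine Prod.ext (funext fun i => ?_) (funext fun e => ?_)
        · simp only [vectorField, h, Pi.add_apply, Prod.fst_add, Prod.snd_add, Matrix.mulVec_add,
            smul_add, Finset.sum_add_distrib, Pi.zero_apply]
          abel
        · simp only [vectorField, h, Pi.add_apply, Prod.snd_add, smul_add, Finset.sum_add_distrib]
      map_smul' := fun a z => by
        have h : output P (a • z) = a • output P z := map_smul (outputL P) a z
        refine Prod.ext (funext fun i => ?_) (funext fun e => ?_)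
        · simp only [vectorField, h, Pi.smul_apply, Prod.smul_fst, Prod.smul_snd,
            Matrix.mulVec_smul, smul_comm _ a, ← Finset.smul_sum, Pi.zero_apply, add_zero, smul_sub,
            smul_neg, RingHom.id_apply]
        · simp only [vectorField, h, Pi.smul_apply, Prod.smul_snd, smul_comm _ a,
            ← Finset.smul_sum, RingHom.id_apply] }

lemma systemL_apply (z : State V E r) : systemL B P z = vectorField B P 0 z := rfl

/-- The damping forces as a linear map. -/
noncomputable def dampingL (P : Params V E r) : State V E r →L[ℝ] (V → Fin r → ℝ) :=
  LinearMap.toContinuousLinearMap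
    { toFun := fun z i => P.R i *ᵥ output P z i
      map_add' := fun z z' => by
        have h : output P (z + z') = output P z + output P z' := map_add (outputL P) z z'
        funext i
        simp [h, Matrix.mulVec_add]
      map_smul' := fun a z => by
        have h : output P (a • z) = a • output P z := map_smul (outputL P) a z
        funext i
        simp [h, Matrix.mulVec_smul] }

lemma dampingL_apply (z : State V E r) (i : V) : dampingL P z i = P.R i *ᵥ output P z i := rfl

lemma IsTrajectory.eq_exp {z : ℝ → State V E r} (hz : IsTrajectory B P 0 z) {t : ℝ} (ht : 0 ≤ t) :
    z t = exp (t • systemL B P) (z 0) :=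
  eq_exp_smul_apply (systemL B P) hz ht

/-- The set `Omega` as a subspace. -/
def omegaSubmodule (B : Matrix V E ℝ) (r : ℕ) : Submodule ℝ (State V E r) where
  carrier := Omega B
  zero_mem' := ⟨0, by ext; simp⟩
  add_mem' := by
    rintro z z' ⟨s, hs⟩ ⟨s', hs'⟩
    exact ⟨s + s', by simp [hs, hs', Finset.sum_add_distrib, funext_iff]⟩
  smul_mem' := by
    rintro a z ⟨s, hs⟩
    refine ⟨a • s, ?_⟩
    funext e
    simp only [Prod.smul_snd, hs, Pi.smul_apply, Finset.smul_sum, smul_comm a]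

lemma systemL_mem_omega (z : State V E r) : systemL B P z ∈ omegaSubmodule B r :=
  ⟨output P z, rfl⟩

/-! ### Energy -/

/-- Twice the total energy of the masses and springs, for diagonal mass and weight matrices. -/
noncomputable def energy (m : V → Fin r → ℝ) (w : E → Fin r → ℝ) (z : State V E r) : ℝ :=
  ∑ i, ∑ k, z.1 i k ^ 2 / m i k + ∑ e, ∑ k, w e k * z.2 e k ^ 2

lemma continuous_energy : Continuous (energy (V := V) m w) := by
  unfold energy
  fun_prop

lemma energy_smul (a : ℝ) (z : State V E r) : energy m w (a • z) = a ^ 2 * energy m w z := by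
  simp only [energy, mul_add, Finset.mul_sum, Prod.smul_fst, Prod.smul_snd, Pi.smul_apply,
    smul_eq_mul]
  congr 1 <;> exact Finset.sum_congr rfl fun i _ => Finset.sum_congr rfl fun k _ => by ring

lemma energy_zero : energy m w (0 : State V E r) = 0 := by
  simp [energy]

lemma energy_pos (hm : ∀ i k, 0 < m i k) (hw : ∀ e k, 0 < w e k) {z : State V E r} (hz : z ≠ 0) :
    0 < energy m w z := by
  have h1 : ∀ i k, 0 ≤ z.1 i k ^ 2 / m i k := fun i k => div_nonneg (sq_nonneg _) (hm i k).le
  have h2 : ∀ e k, 0 ≤ w e k * z.2 e k ^ 2 := fun e k => mul_nonneg (hw e k).le (sq_nonneg _)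
  have h3 : 0 ≤ ∑ i, ∑ k, z.1 i k ^ 2 / m i k :=
    Finset.sum_nonneg fun i _ => Finset.sum_nonneg fun k _ => h1 i k
  have h4 : 0 ≤ ∑ e, ∑ k, w e k * z.2 e k ^ 2 :=
    Finset.sum_nonneg fun e _ => Finset.sum_nonneg fun k _ => h2 e k
  refine lt_of_le_of_ne (add_nonneg h3 h4) fun h => hz ?_
  obtain ⟨h5, h6⟩ := (add_eq_zero_iff_of_nonneg h3 h4).1 h.symm
  refine Prod.ext (funext fun i => funext fun k => ?_) (funext fun e => funext fun k => ?_)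
  · have := (Finset.sum_eq_zero_iff_of_nonneg fun i _ => Finset.sum_nonneg fun k _ => h1 i k).1 h5
      i (Finset.mem_univ i)
    have := (Finset.sum_eq_zero_iff_of_nonneg fun k _ => h1 i k).1 this k (Finset.mem_univ k)
    simpa [(hm i k).ne'] using this
  · have := (Finset.sum_eq_zero_iff_of_nonneg fun e _ => Finset.sum_nonneg fun k _ => h2 e k).1 h6
      e (Finset.mem_univ e)
    have := (Finset.sum_eq_zero_iff_of_nonneg fun k _ => h2 e k).1 this k (Finset.mem_univ k)
    simpa [(hw e k).ne'] using this

/-- The springs exchange energy with the masses without loss; only the dampers dissipate. -/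
lemma hasDerivAt_energy (hm : ∀ i k, 0 < m i k) (hM : ∀ i, P.M i = Matrix.diagonal (m i))
    (hW : ∀ e, P.W e = Matrix.diagonal (w e)) {z : ℝ → State V E r} {t : ℝ}
    (hz : HasDerivAt z (systemL B P (z t)) t) :
    HasDerivAt (fun t => energy m w (z t))
      (-2 * ∑ i, output P (z t) i ⬝ᵥ dampingL P (z t) i) t := by
  have h1 : ∀ i k, HasDerivAt (fun t => (z t).1 i k) ((systemL B P (z t)).1 i k) t := fun i k =>
    hasDerivAt_pi.1 (hasDerivAt_pi.1 hz.fst i) k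
  have h2 : ∀ e k, HasDerivAt (fun t => (z t).2 e k) ((systemL B P (z t)).2 e k) t := fun e k =>
    hasDerivAt_pi.1 (hasDerivAt_pi.1 hz.snd e) k
  have h3 := (HasDerivAt.fun_sum fun i (_ : i ∈ Finset.univ) =>
    HasDerivAt.fun_sum fun k (_ : k ∈ Finset.univ) => ((h1 i k).pow 2).div_const (m i k)).add
    (HasDerivAt.fun_sum fun e (_ : e ∈ Finset.univ) =>
    HasDerivAt.fun_sum fun k (_ : k ∈ Finset.univ) => ((h2 e k).pow 2).const_mul (w e k))
  refine h3.congr_deriv ?_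
  set y := output P (z t) with hy
  have hswap : ∑ i, ∑ k, y i k * ∑ e, B i e * (w e k * (z t).2 e k) =
      ∑ e, ∑ k, w e k * (z t).2 e k * ∑ i, B i e * y i k := by
    simp only [Finset.mul_sum]
    calc _ = ∑ i, ∑ e, ∑ k, y i k * (B i e * (w e k * (z t).2 e k)) :=
          Finset.sum_congr rfl fun i _ => Finset.sum_comm
      _ = ∑ e, ∑ i, ∑ k, y i k * (B i e * (w e k * (z t).2 e k)) := Finset.sum_comm
      _ = ∑ e, ∑ k, ∑ i, y i k * (B i e * (w e k * (z t).2 e k)) :=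
          Finset.sum_congr rfl fun e _ => Finset.sum_comm
      _ = _ := Finset.sum_congr rfl fun e _ => Finset.sum_congr rfl fun k _ =>
          Finset.sum_congr rfl fun i _ => by ring
  have hp : ∑ i, ∑ k, ((2 : ℕ) : ℝ) * (z t).1 i k ^ (2 - 1) * (systemL B P (z t)).1 i k / m i k =
      -2 * (∑ i, y i ⬝ᵥ dampingL P (z t) i) -
        2 * ∑ i, ∑ k, y i k * ∑ e, B i e * (w e k * (z t).2 e k) := by
    simp only [dotProduct, Finset.mul_sum _ _ (2 : ℝ), Finset.mul_sum _ _ (-2 : ℝ),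
      ← Finset.sum_sub_distrib]
    refine Finset.sum_congr rfl fun i _ => Finset.sum_congr rfl fun k _ => ?_
    rw [systemL_apply, vectorField_fst_apply B hW, dampingL_apply, ← hy, hy,
      output_apply hm hM, ← hy]
    simp only [Pi.zero_apply, add_zero]
    ring
  have hq : ∑ e, ∑ k, w e k * (((2 : ℕ) : ℝ) * (z t).2 e k ^ (2 - 1) * (systemL B P (z t)).2 e k) =
      2 * ∑ e, ∑ k, w e k * (z t).2 e k * ∑ i, B i e * y i k := by
    simp only [Finset.mul_sum _ _ (2 : ℝ)]
    refine Finset.sum_congr rfl fun e _ => Finset.sum_congr rfl fun k _ => ?_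
    rw [systemL_apply, vectorField_snd_apply, ← hy]
    ring
  rw [hp, hq, hswap]
  ring

end

end MassSpring

/-! ### Asymptotic stability and output consensus -/

namespace MassSpring

open Filter NormedSpace

section
variable {V : Type*} [Fintype V] {G : SimpleGraph V} [Fintype G.edgeSet] {B : Matrix V G.edgeSet ℝ}
  {Vd : Set V} {r : ℕ} {P : Params V G.edgeSet r}
  {m : V → Fin r → ℝ} {w : G.edgeSet → Fin r → ℝ}

lemma dissipation_nonneg (hP : P.Feasible Vd) (z : State V G.edgeSet r) (i : V) :
    0 ≤ output P z i ⬝ᵥ dampingL P z i := by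
  simpa [dampingL_apply] using (hP.2.2.1 i).dotProduct_mulVec_nonneg (output P z i)

/-- A state in `Ω` whose trajectory feels no damping force is the origin: these states form a
subspace that is invariant under the dynamics, so each coordinate of their velocities runs through a
subspace that is invariant under `M⁻¹ L`. -/
lemma eq_zero_of_damping_eq_zero (hG : G.Connected) (hVd : Vd.Nonempty)
    (hB : IsOrientedIncidence G B)
    (hker : ∀ (m : V → ℝ) (w : G.edgeSet → ℝ) (x : V → ℝ), (∀ i, 0 < m i) →
      (∀ e, 0 < w e) → (∀ i, lap B w x i = m i * x i) → (∀ i ∈ Vd, x i = 0) → x = 0)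
    (hP : P.Feasible Vd) {z : State V G.edgeSet r} (hz : z ∈ Omega B)
    (hd : ∀ t : ℝ, 0 ≤ t → dampingL P (exp (t • systemL B P) z) = 0) : z = 0 := by
  obtain ⟨m, w, hm, hw, hM, hW⟩ := hP.exists_diagonal
  let N : Submodule ℝ (State V G.edgeSet r) :=
    { carrier := {z | z ∈ omegaSubmodule B r ∧
        ∀ t : ℝ, 0 ≤ t → dampingL P (exp (t • systemL B P) z) = 0}
      zero_mem' := ⟨zero_mem _, fun t _ => by simp⟩
      add_mem' := fun {a b} ha hb => ⟨add_mem ha.1 hb.1, fun t ht => by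
        rw [map_add, map_add, ha.2 t ht, hb.2 t ht, add_zero]⟩
      smul_mem' := fun a z hz => ⟨Submodule.smul_mem _ _ hz.1, fun t ht => by
        rw [map_smul, map_smul, hz.2 t ht, smul_zero]⟩ }
  have hNinv : ∀ z ∈ N, systemL B P z ∈ N := fun z hz =>
    ⟨systemL_mem_omega B z, fun t ht => unobservable_apply _ _ hz.2 ht⟩
  have hNdamp : ∀ z ∈ N, dampingL P z = 0 := fun z hz => by simpa using hz.2 0 le_rfl
  have hNp : ∀ z ∈ N, ∀ i k, (systemL B P z).1 i k = -∑ e, B i e * (w e k * z.2 e k) := by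
    intro z hz i k
    have h : P.R i *ᵥ output P z i = 0 := congrFun (hNdamp z hz) i
    rw [systemL_apply, vectorField_fst_apply B hW, h]
    simp
  have hNVd : ∀ z ∈ N, ∀ i ∈ Vd, output P z i = 0 := by
    intro z hz i hi
    by_contra hne
    have h1 := ((hP.2.2.2 i).2 hi).dotProduct_mulVec_pos hne
    have h2 : P.R i *ᵥ output P z i = 0 := congrFun (hNdamp z hz) i
    simp [h2] at h1
  have hNp0 : ∀ z ∈ N, ∀ i k, z.1 i k = 0 := by
    intro z hz i k
    -- `S` consists of the `k`-th coordinates of the velocities of unobservable states.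
    let S : Submodule ℝ (V → ℝ) :=
      N.map ((LinearMap.pi fun i => LinearMap.proj k ∘ₗ LinearMap.proj i) ∘ₗ
        (outputL P : State V G.edgeSet r →ₗ[ℝ] (V → Fin r → ℝ)))
    have hmem : ∀ y, y ∈ S ↔ ∃ z ∈ N, (fun i => output P z i k) = y := fun y => Iff.rfl
    have h0 : (fun i => output P z i k) = 0 := by
      refine eq_zero_of_invariant hG hVd hB hker (m := fun i => m i k) (w := fun e => w e k)
        (fun i => hm i k) (fun e => hw e k) (S := S) ?_ ?_ ((hmem _).2 ⟨z, hz, rfl⟩)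
      · rintro _ ⟨z, hz, rfl⟩ i hi
        exact congrFun (hNVd z hz i hi) k
      · rintro _ ⟨z, hz, rfl⟩
        refine (hmem _).2 ⟨-systemL B P (systemL B P z), neg_mem (hNinv _ (hNinv _ hz)), ?_⟩
        funext i
        rw [output_apply hm hM, Prod.fst_neg, Pi.neg_apply, Pi.neg_apply,
          hNp _ (hNinv _ hz), neg_neg]
        simp only [systemL_apply, vectorField_snd_apply]
        rfl
    have h1 := congrFun h0 i
    rw [output_apply hm hM, Pi.zero_apply, div_eq_zero_iff] at h1
    exact h1.resolve_right (hm i k).ne'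
  have hzN : z ∈ N := ⟨hz, hd⟩
  refine Prod.ext (funext fun i => funext fun k => hNp0 z hzN i k)
    (funext fun e => funext fun k => ?_)
  -- The momenta stay zero, so the spring forces balance; as `q` is in the range of `Bᵀ`, it is zero.
  obtain ⟨s, hs⟩ := hz
  have hq : ∀ e, z.2 e k = ∑ i, B i e * s i k := fun e => by simp [hs, Finset.sum_apply]
  have hl : ∀ i, lap B (fun e => w e k) (fun i => s i k) i = 0 := by
    intro i
    have h1 := hNp0 _ (hNinv z hzN) i k
    rw [hNp z hzN, neg_eq_zero] at h1
    simp only [hq] at h1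
    exact h1
  rw [hq]
  exact edge_eq_zero_of_sum_mul_lap_self B (fun e => hw e k) (by simp [hl]) e

/-- The kernel condition implies asymptotic stability. -/
lemma isGAS_of_kernel (hG : G.Connected) (hVd : Vd.Nonempty) (hB : IsOrientedIncidence G B)
    (hker : ∀ (m : V → ℝ) (w : G.edgeSet → ℝ) (x : V → ℝ), (∀ i, 0 < m i) →
      (∀ e, 0 < w e) → (∀ i, lap B w x i = m i * x i) → (∀ i ∈ Vd, x i = 0) → x = 0)
    (hP : P.Feasible Vd) : IsGAS B P := by
  obtain ⟨m, w, hm, hw, hM, hW⟩ := hP.exists_diagonal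
  obtain ⟨c, hc0, hbound⟩ := exists_mul_sq_norm_le (continuous_energy (V := V) (m := m) (w := w))
    energy_smul fun z hz => energy_pos hm hw hz
  have hderiv : ∀ z (t : ℝ), HasDerivAt (fun t : ℝ => energy m w (exp (t • systemL B P) z))
      (-2 * ∑ i, output P (exp (t • systemL B P) z) i ⬝ᵥ
        dampingL P (exp (t • systemL B P) z) i) t := fun z t =>
    hasDerivAt_energy B hm hM hW (hasDerivAt_exp_smul_apply _ z t)
  have hanti : ∀ z, Antitone fun t : ℝ => energy m w (exp (t • systemL B P) z) := fun z =>
    antitone_of_hasDerivAt_nonpos (hderiv z) fun t => by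
      have := Finset.sum_nonneg fun i (_ : i ∈ Finset.univ) =>
        dissipation_nonneg hP (exp (t • systemL B P) z) i
      rw [Pi.zero_apply]
      linarith
  have hmono : ∀ z (t : ℝ), 0 ≤ t → energy m w (exp (t • systemL B P) z) ≤ energy m w z :=
    fun z t ht => by simpa using hanti z ht
  refine ⟨fun ε hε => ?_, fun z hz hz0 => ?_⟩
  · obtain ⟨δ, hδ, h⟩ := stable_of_energy (Φ := fun t z => exp (t • systemL B P) z)
      continuous_energy energy_zero hc0 hbound hmono hε
    refine ⟨δ, hδ, fun z hz _ hzδ t ht => ?_⟩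
    rw [hz.eq_exp B ht]
    exact h _ hzδ t ht
  · refine (tendsto_zero_of_energy (systemL B P) continuous_energy energy_zero hc0 hbound hmono
      (S := omegaSubmodule B r)
      (fun y hy t => exp_smul_apply_mem _ (systemL_mem_omega B) hy t) (fun y hy hconst => ?_)
      hz0).congr' ((eventually_ge_atTop 0).mono fun t ht => (hz.eq_exp B ht).symm)
    refine eq_zero_of_damping_eq_zero hG hVd hB hker hP hy fun t ht => ?_
    have h1 : HasDerivWithinAt (fun t : ℝ => energy m w (exp (t • systemL B P) y)) 0
        (Set.Ici 0) t :=
      (hasDerivWithinAt_const t _ (energy m w y)).congr (fun s hs => hconst s hs) (hconst t ht)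
    have h2 := (uniqueDiffOn_Ici (0 : ℝ) t ht).eq_deriv _ (hderiv y t).hasDerivWithinAt h1
    have h3 : ∑ i, output P (exp (t • systemL B P) y) i ⬝ᵥ
        dampingL P (exp (t • systemL B P) y) i = 0 := by linarith
    rw [Finset.sum_eq_zero_iff_of_nonneg fun i _ => dissipation_nonneg hP _ i] at h3
    funext i
    exact ((hP.2.2.1 i).dotProduct_mulVec_zero_iff _).1 
      (by simpa [dampingL_apply] using h3 i (Finset.mem_univ i))

/-- For every constant input and every initial elongation there is an equilibrium with a common
velocity `c` of all nodes whose elongation differs from the initial one by an element of the range of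
`Bᵀ`. The sum of the force balances over the nodes determines `c`. -/
lemma exists_equilibrium (hG : G.Connected) (hVd : Vd.Nonempty) (hB : IsOrientedIncidence G B)
    (hP : P.Feasible Vd) (v : V → Fin r → ℝ) (q : G.edgeSet → Fin r → ℝ) :
    ∃ (c : Fin r → ℝ) (z : State V G.edgeSet r), vectorField B P v z = 0 ∧
      (∀ i, output P z i = c) ∧ ∃ s : V → Fin r → ℝ, z.2 = q + fun e => ∑ i, B i e • s i := by
  classical
  obtain ⟨m, w, hm, hw, hM, hW⟩ := hP.exists_diagonal
  have hR : (∑ i, P.R i).PosDef := by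
    obtain ⟨a, ha⟩ := hVd
    rw [← Finset.add_sum_erase _ _ (Finset.mem_univ a)]
    exact ((hP.2.2.2 a).2 ha).add_posSemidef (Matrix.posSemidef_sum _ fun i _ => hP.2.2.1 i)
  obtain ⟨c, hc⟩ : ∃ c, (∑ i, P.R i) *ᵥ c = ∑ i, v i :=
    ⟨(∑ i, P.R i)⁻¹ *ᵥ ∑ i, v i, by
      rw [Matrix.mulVec_mulVec,
        Matrix.mul_nonsing_inv _ ((Matrix.isUnit_iff_isUnit_det _).1 hR.isUnit), Matrix.one_mulVec]⟩
  have hsolve : ∀ k, ∃ s, lap B (fun e => w e k) s =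
      fun i => v i k - (P.R i *ᵥ c) k - ∑ e, B i e * (w e k * q e k) := by
    intro k
    refine hB.exists_lap_eq hG (fun e => hw e k) ?_
    have h1 : ∑ i, (P.R i *ᵥ c) k = ∑ i, v i k := by
      have := congrFun hc k
      rw [Matrix.sum_mulVec] at this
      simpa [Finset.sum_apply] using this
    have h2 : ∑ i, ∑ e, B i e * (w e k * q e k) = 0 := by
      rw [Finset.sum_comm]
      refine Finset.sum_eq_zero fun e _ => ?_
      rw [← Finset.sum_mul, hB.sum_column, zero_mul]
    rw [Finset.sum_sub_distrib, Finset.sum_sub_distrib, h1, h2]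
    simp
  choose s hs using hsolve
  let z : State V G.edgeSet r :=
    (fun i k => m i k * c k, q + fun e => ∑ i, B i e • fun k => s k i)
  have hout : ∀ i, output P z i = c := by
    intro i
    funext k
    rw [output_apply hm hM]
    exact mul_div_cancel_left₀ _ (hm i k).ne'
  refine ⟨c, z, ?_, hout, fun i k => s k i, rfl⟩
  refine Prod.ext (funext fun i => funext fun k => ?_) (funext fun e => funext fun k => ?_)
  · rw [vectorField_fst_apply B hW, hout]
    have h1 := congrFun (hs k) i
    have h2 : ∑ e, B i e * (w e k * z.2 e k) =
        ∑ e, B i e * (w e k * q e k) + lap B (fun e => w e k) (s k) i := by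
      rw [lap, ← Finset.sum_add_distrib]
      refine Finset.sum_congr rfl fun e _ => ?_
      simp only [z, Pi.add_apply, Finset.sum_apply, Pi.smul_apply, smul_eq_mul]
      ring
    rw [h2, h1]
    change _ = (0 : ℝ)
    ring
  · rw [vectorField_snd_apply]
    simp only [hout, ← Finset.sum_mul, hB.sum_column]
    simp

/-- Trajectories relative to an equilibrium are trajectories of the system without input. -/
lemma outputConsensus_of_isGAS (hG : G.Connected) (hVd : Vd.Nonempty)
    (hB : IsOrientedIncidence G B) (hP : P.Feasible Vd) (h : IsGAS B P) (v : V → Fin r → ℝ) :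
    OutputConsensus B P v := by
  intro z hz
  obtain ⟨c, u, hu, hout, s, hs⟩ := exists_equilibrium hG hVd hB hP v (z 0).2
  have htraj : IsTrajectory B P 0 fun t => z t - u := by
    intro t ht
    refine ((hz t ht).sub_const u).congr_deriv ?_
    rw [← sub_zero (vectorField B P v (z t)), ← hu, vectorField_eq_add, vectorField_eq_add B v u,
      add_sub_add_right_eq_sub, ← systemL_apply, ← systemL_apply, ← systemL_apply, map_sub]
  have h0 : z 0 - u ∈ Omega B := by
    refine ⟨-s, ?_⟩
    rw [Prod.snd_sub, hs]
    funext e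
    simp
  have hlim := ((outputL P).continuous.tendsto 0).comp (h.2 _ htraj h0)
  refine ⟨c, ?_⟩
  have h1 : output P u = fun _ => c := funext hout
  have h2 := hlim.add_const (output P u)
  rw [map_zero, h1, zero_add] at h2
  refine h2.congr fun t => ?_
  rw [Function.comp_apply, map_sub, outputL_apply, outputL_apply, h1, sub_add_cancel]

/-- A vector in the kernel of `L - M` that vanishes on the damped nodes yields an undamped
oscillation of angular frequency one, whose output does not converge. -/
lemma exists_oscillation (hr : 0 < r) {m : V → ℝ} {w : G.edgeSet → ℝ} {x : V → ℝ}
    (hm : ∀ i, 0 < m i) (hw : ∀ e, 0 < w e) (hx : ∀ i, lap B w x i = m i * x i)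
    (hxd : ∀ i ∈ Vd, x i = 0) (hx0 : x ≠ 0) :
    ∃ P : Params V G.edgeSet r, P.Feasible Vd ∧ (∀ i, i ∉ Vd → P.R i = 0) ∧
      ∃ z, IsTrajectory B P 0 z ∧ z 0 ∈ Omega B ∧
        ∀ c : Fin r → ℝ, ¬ Tendsto (fun t => output P (z t)) atTop (𝓝 fun _ => c) := by
  classical
  let P : Params V G.edgeSet r :=
    { M := fun i => Matrix.diagonal fun _ => m i
      R := fun i => if i ∈ Vd then 1 else 0
      W := fun e => Matrix.diagonal fun _ => w e }
  have hP : P.Feasible Vd := by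
    refine ⟨fun i => ⟨Matrix.isDiag_diagonal _, Matrix.posDef_diagonal_iff.2 fun _ => hm i⟩,
      fun e => ⟨Matrix.isDiag_diagonal _, Matrix.posDef_diagonal_iff.2 fun _ => hw e⟩,
      fun i => ?_, fun i => ?_⟩
    · by_cases hi : i ∈ Vd
      · simpa [P, hi] using Matrix.PosSemidef.one
      · simpa [P, hi] using Matrix.PosSemidef.zero
    · by_cases hi : i ∈ Vd
      · simpa [P, hi] using Matrix.PosDef.one
      · have : Nonempty (Fin r) := ⟨⟨0, hr⟩⟩
        simp only [P, hi, if_false, iff_false]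
        intro h
        have := h.diag_pos (i := ⟨0, hr⟩)
        simp at this
  let z : ℝ → State V G.edgeSet r := fun t =>
    (fun i _ => m i * x i * Real.cos t, fun e _ => (∑ i, B i e * x i) * Real.sin t)
  have hout : ∀ t i k, output P (z t) i k = x i * Real.cos t := by
    intro t i k
    rw [output_apply (m := fun i _ => m i) (fun i _ => hm i) fun _ => rfl]
    change m i * x i * Real.cos t / m i = _
    rw [mul_assoc, mul_div_cancel_left₀ _ (hm i).ne']
  refine ⟨P, hP, fun i hi => if_neg hi, z, fun t _ => HasDerivAt.hasDerivWithinAt ?_,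
    ⟨0, by simp [z]; rfl⟩, fun c hc => ?_⟩
  · have h1 : HasDerivAt z ((fun i _ => m i * x i * -Real.sin t,
        fun e _ => (∑ i, B i e * x i) * Real.cos t) : State V G.edgeSet r) t :=
      HasDerivAt.prodMk
        (hasDerivAt_pi.2 fun i => hasDerivAt_pi.2 fun _ => (Real.hasDerivAt_cos t).const_mul _)
        (hasDerivAt_pi.2 fun e => hasDerivAt_pi.2 fun _ => (Real.hasDerivAt_sin t).const_mul _)
    refine h1.congr_deriv ?_
    refine Prod.ext (funext fun i => funext fun k => ?_) (funext fun e => funext fun k => ?_)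
    · rw [vectorField_fst_apply (w := fun e _ => w e) B fun _ => rfl]
      have h2 : (P.R i *ᵥ output P (z t) i) k = 0 := by
        by_cases hi : i ∈ Vd
        · simp [P, hi]
          rw [hout, hxd i hi, zero_mul]
        · simp [P, hi]
      have h3 : ∑ e, B i e * (w e * (z t).2 e k) = lap B w x i * Real.sin t := by
        rw [lap, Finset.sum_mul]
        refine Finset.sum_congr rfl fun e _ => ?_
        simp only [z]
        ring
      rw [h2, h3, hx]
      simp
    · rw [vectorField_snd_apply]
      refine (Finset.sum_mul _ _ _).trans ?_
      refine Finset.sum_congr rfl fun i _ => ?_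
      rw [hout]
      ring
  · obtain ⟨i, hi⟩ := Function.ne_iff.1 hx0
    -- The velocity of node `i` is `x i` at even and `-x i` at odd multiples of `π`.
    have h1 : Tendsto (fun t => x i * Real.cos t) atTop (𝓝 (c ⟨0, hr⟩)) := by
      have := tendsto_pi_nhds.1 (tendsto_pi_nhds.1 hc i) ⟨0, hr⟩
      simpa only [hout] using this
    have hlim : Tendsto (fun n : ℕ => (n : ℝ) * (2 * Real.pi)) atTop atTop :=
      tendsto_natCast_atTop_atTop.atTop_mul_const (by positivity)
    have h2 := h1.comp hlim
    have h3 := h1.comp (tendsto_atTop_add_const_right _ Real.pi hlim)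
    simp only [Function.comp_def, Real.cos_nat_mul_two_pi, Real.cos_nat_mul_two_pi_add_pi,
      mul_one, mul_neg] at h2 h3
    have h4 := tendsto_nhds_unique h2 tendsto_const_nhds
    have h5 := tendsto_nhds_unique h3 tendsto_const_nhds
    exact hi (show x i = 0 by linarith)

end

end MassSpring

theorem proposition5p5 {V : Type*} [Fintype V] [DecidableEq V]
    (G : SimpleGraph V) [DecidableRel G.Adj] (hG : G.Connected)
    (Vd : Set V) (hVd : Vd.Nonempty)
    (B : Matrix V G.edgeSet ℝ) (hB : MassSpring.IsOrientedIncidence G B)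
    (r : ℕ) (hr : 0 < r) :
    List.TFAE [
      -- parameter-independent stability, in three versions
      MassSpring.IsPIGAS r B Vd,
      MassSpring.IsPIGASUndamped r B Vd,
      MassSpring.IsPIConsensus r B Vd,
      -- the kernel condition
      MassSpring.kernelUnion B Vd = {0},
      -- no nonzero real vector, and no nonzero sign vector, is balanced at its zeros
      ¬ ∃ x : V → ℝ, x ≠ 0 ∧ MassSpring.ZeroBalanced G Vd x,
      ¬ ∃ x : V → SignType, x ≠ 0 ∧ MassSpring.ZeroBalanced G Vd x,
      -- no richly balanced coloring
      ¬ ∃ c : V → MassSpring.Color,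
        MassSpring.IsColoring Vd c ∧ MassSpring.RichlyBalanced G c,
      ¬ ∃ c : V → MassSpring.Color, MassSpring.IsColoring Vd c ∧
        (∀ i, c i = MassSpring.Color.black →
          ((∃ j, G.Adj i j ∧ c j = MassSpring.Color.blue) ↔
            (∃ k, G.Adj i k ∧ c k = MassSpring.Color.red))) ∧
        (∃ i, c i ≠ MassSpring.Color.black),
      -- every node is uncolorable
      MassSpring.uncolorable G Vd = Set.univ] := by
  tfae_have 1 → 2 := fun h P hP _ => h P hP
  tfae_have 1 → 3 := fun h P hP v =>
    MassSpring.outputConsensus_of_isGAS hG hVd hB hP (h P hP) v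
  tfae_have 4 → 1 := fun h P hP =>
    MassSpring.isGAS_of_kernel hG hVd hB
      ((MassSpring.kernelUnion_eq_singleton_iff B Vd).1 h) hP
  tfae_have 2 → 4 := by
    rw [MassSpring.kernelUnion_eq_singleton_iff]
    intro h m w x hm hw hx hxd
    by_contra hx0
    obtain ⟨P, hP, hR, z, hz, hz0, hlim⟩ :=
      MassSpring.exists_oscillation hr hm hw hx hxd hx0
    have h1 := ((MassSpring.outputL P).continuous.tendsto 0).comp ((h P hP hR).2 z hz hz0)
    rw [map_zero] at h1
    exact hlim 0 h1
  tfae_have 3 → 4 := by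
    rw [MassSpring.kernelUnion_eq_singleton_iff]
    intro h m w x hm hw hx hxd
    by_contra hx0
    obtain ⟨P, hP, -, z, hz, -, hlim⟩ :=
      MassSpring.exists_oscillation hr hm hw hx hxd hx0
    obtain ⟨c, hc⟩ := h P hP 0 z hz
    exact hlim c hc
  tfae_have 5 → 4 := by
    rw [MassSpring.kernelUnion_eq_singleton_iff]
    intro h m w x hm hw hx hxd
    by_contra hx0
    exact h ⟨x, hx0, MassSpring.zeroBalanced_of_lap_eq hB hw hx hxd⟩
  tfae_have 4 → 6 := by
    rw [MassSpring.kernelUnion_eq_singleton_iff]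
    rintro h ⟨x, hx0, hx⟩
    obtain ⟨m, w, y, hm, hw, hy, hyd, hy0⟩ :=
      MassSpring.exists_lap_eq_of_zeroBalanced hB hG hVd hx0 hx
    exact hy0 (h m w y hm hw hy hyd)
  tfae_have 5 ↔ 6 := not_congr (MassSpring.exists_zeroBalanced_real_iff_sign G Vd)
  tfae_have 6 ↔ 8 := not_congr (MassSpring.exists_zeroBalanced_sign_iff_coloring G Vd)
  tfae_have 8 ↔ 7 := not_congr (MassSpring.exists_coloring_iff_richlyBalanced hG hVd)
  tfae_have 9 ↔ 7 := MassSpring.uncolorable_eq_univ_iff G Vd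
  tfae_finish
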